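/- Work over $\mathbb{C}$; a variety is an integral separated scheme of finite type over $\mathbb{C}$. Let $X$ be a variety and let $x\in X$ be a closed point at which $X$ is smooth, with local ring $(\mathcal{O}_{X,x},\mathfrak{m}_x)$. For $g\in\mathcal{O}_{X,x}$ put $\mathrm{mult}_x(g)=\sup\{k : g\in\mathfrak{m}_x^k\}$ (so $\mathrm{mult}_x(0)=\infty$). Let $\nu=\mathrm{ord}_E$ be a divisorial valuation over $X$, i.e. the order of vanishing along a prime divisor $E$ on a normal variety $Y$ equipped with a birational morphism $f:Y\to X$; its center on $X$ is $Z=\overline{f(E)}$. Whenever $x\in Z$ (so that $\nu\ge 0$ on $\mathcal{O}_{X,x}$) put $\nu(\mathfrak{m}_x)=\min\{\nu(g): g\in\mathfrak{m}_x\}$, and let $a(\nu)$ be the discrepancy of $E$ over $X$: the coefficient of $E$ in $K_Y-f^*K_X$ (well defined near the generic point of $Z$, where $X$ is smooth), that is, the order of vanishing along $E$ of $f^*\omega$, where $\omega$ is a local generator of the canonical sheaf $\omega_X$ at the generic point of $Z$. (1) If $x\in Z$ and $Z$ has codimension at least $2$ in $X$, then for all $g\in\mathcal{O}_{X,x}$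 $$\nu(\mathfrak{m}_x)\cdot\mathrm{mult}_x(g)\;\le\;\nu(g)\;\le\; a(\nu)\cdot\mathrm{mult}_x(g).$$ (2) The constant $a(\nu)$ is sharp: if $X$ is a surface, then there is a divisorial valuation $\nu$ over $X$ whose center contains $x$ and has codimension at least $2$, with $\nu(g)=\mathrm{mult}_x(g)$ for all $g\in\mathcal{O}_{X,x}$; and every divisorial valuation $\nu$ over $X$ whose center contains $x$ and which equals $\mathrm{mult}_x$ on $\mathcal{O}_{X,x}$ satisfies $\nu(g)=a(\nu)\cdot\mathrm{mult}_x(g)$ for all $g\in\mathcal{O}_{X,x}$. -/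

import Mathlib

open AlgebraicGeometry CategoryTheory
open scoped KaehlerDifferential

noncomputable section

namespace Izumi

/-! ### Orders in local rings -/

/-- The order of an element `g` of a local ring `R`: the supremum in `ℕ∞` of all `k` with
`g ∈ 𝔪 ^ k`. For `R = 𝒪_{X,x}` this is the multiplicity `mult_x g` (with `mult_x 0 = ⊤`). -/
def mult (R : Type*) [CommRing R] [IsLocalRing R] (g : R) : ℕ∞ :=
  ⨆ (k : ℕ) (_ : g ∈ IsLocalRing.maximalIdeal R ^ k), (k : ℕ∞)

/-! ### Pull-back of top differential forms -/

/-- For `k`-algebras `A`, `B` and an algebra map `A → B`, the `B`-submodule of `⋀^n Ω_{B/k}`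
generated by the pull-backs of the `n`-forms on `A`, i.e. by all `da₁ ∧ ⋯ ∧ daₙ` with `aᵢ ∈ A`. -/
def pullbackForms (k A B : Type*) [CommRing k] [CommRing A] [CommRing B] [Algebra k B]
    [Algebra A B] (n : ℕ) : Submodule B (⋀[B]^n (Ω[B⁄k])) :=
  Submodule.span B (Set.range fun a : Fin n → A =>
    exteriorPower.ιMulti B n fun i => KaehlerDifferential.D k B (algebraMap A B (a i)))

/-- The order of vanishing along (the closed point of) `B` of the pull-back of a generator of the
canonical module `⋀^n Ω_{A/k}`, `n = rank Ω_{A/k}`: the largest `r` such that all pulled back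
top forms lie in `𝔪_B ^ r • ⋀^n Ω_{B/k}`. -/
def jacobianOrder (k A B : Type*) [CommRing k] [CommRing A] [CommRing B] [Algebra k A]
    [Algebra k B] [Algebra A B] [IsLocalRing B] : ℕ :=
  sSup {r : ℕ | pullbackForms k A B (Module.finrank A (Ω[A⁄k])) ≤
    IsLocalRing.maximalIdeal B ^ r •
      (⊤ : Submodule B (⋀[B]^(Module.finrank A (Ω[A⁄k])) (Ω[B⁄k])))}

/-! ### Complex varieties, smooth points, prime divisors over a variety -/

/-- `X` with structure morphism `s : X ⟶ Spec ℂ` is a complex variety: integral, separated and of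
finite type over `ℂ`. -/
structure IsVariety {X : Scheme.{0}} (s : X ⟶ Spec (.of ℂ)) : Prop where
  isIntegral : IsIntegral X
  isSeparated : IsSeparated s
  locallyOfFiniteType : LocallyOfFiniteType s
  quasiCompact : QuasiCompact s

/-- `x` is a smooth point of `X` over `ℂ`: some open neighbourhood of `x` is smooth over `ℂ`. -/
def IsSmoothPoint {X : Scheme.{0}} (s : X ⟶ Spec (.of ℂ)) (x : X) : Prop :=
  ∃ U : X.Opens, x ∈ U ∧ Smooth (U.ι ≫ s)

/-- The `ℂ`-algebra structure map `ℂ → 𝒪_{X,x}`. -/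
def stalkStructureMap {X : Scheme.{0}} (s : X ⟶ Spec (.of ℂ)) (x : X) :
    ℂ →+* X.presheaf.stalk x :=
  ((Scheme.ΓSpecIso (.of ℂ)).inv ≫ s.appTop ≫ X.presheaf.germ ⊤ x trivial).hom

/-- A prime divisor over `X`: a normal variety `Y` with a birational morphism `f : Y ⟶ X` over
`ℂ`, and a prime divisor of `Y`, given by its generic point `η` (a point of codimension one).
Birational means that `f` restricts to an isomorphism from a nonempty (hence dense) open subset
of `Y` to an open subset of `X`. -/
structure DivisorOver {X : Scheme.{0}} (s : X ⟶ Spec (.of ℂ)) where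
  /-- the birational model -/
  Y : Scheme.{0}
  /-- the birational morphism -/
  f : Y ⟶ X
  isVariety : IsVariety (f ≫ s)
  normal : ∀ y : Y, IsIntegrallyClosed (Y.presheaf.stalk y)
  birational : ∃ V : Y.Opens, (V : Set Y).Nonempty ∧ IsOpenImmersion (V.ι ≫ f)
  /-- the generic point of the divisor -/
  η : Y
  codim_one : Order.coheight η = 1

namespace DivisorOver

variable {X : Scheme.{0}} {s : X ⟶ Spec (.of ℂ)} (E : DivisorOver s)

instance : IsIntegral E.Y := E.isVariety.isIntegral

/-- The local ring of `Y` at the generic point of `E` is a discrete valuation ring. -/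
instance : IsDiscreteValuationRing (E.Y.presheaf.stalk E.η) := by
  have h1 := E.isVariety.locallyOfFiniteType
  have : IsLocallyNoetherian E.Y := LocallyOfFiniteType.isLocallyNoetherian (E.f ≫ s)
  have h2 : ringKrullDim (E.Y.presheaf.stalk E.η) = 1 := by
    rw [ringKrullDim_stalk_eq_coheight, E.codim_one]; rfl
  have h3 := E.normal E.η
  have h4 : ¬ IsField (E.Y.presheaf.stalk E.η) := fun h => by
    rw [ringKrullDim_eq_zero_of_isField h] at h2
    exact zero_ne_one h2
  have h5 : Ring.KrullDimLE 1 (E.Y.presheaf.stalk E.η) := Ring.krullDimLE_iff.mpr h2.le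
  have h6 : Ring.DimensionLEOne (E.Y.presheaf.stalk E.η) :=
    ⟨fun {p} hp hp' => Ring.krullDimLE_one_iff_of_isPrime_bot.mp h5 p hp hp'⟩
  have h7 : IsDedekindRing (E.Y.presheaf.stalk E.η) := {}
  have h8 : IsDedekindDomain (E.Y.presheaf.stalk E.η) := {}
  exact ((IsDiscreteValuationRing.TFAE _ h4).out 0 2).mpr h8

/-- The valuation `ν = ord_E` on `𝒪_{Y,E}`, normalized to have value group `ℤ`. -/
def ord : AddValuation (E.Y.presheaf.stalk E.η) ℕ∞ :=
  IsDiscreteValuationRing.addVal (E.Y.presheaf.stalk E.η)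

/-- The generic point of the center of `E` on `X`. -/
def centerPt : X := E.f E.η

/-- The center of `E` on `X`. -/
def center : Set X := closure {E.centerPt}

/-- For `x` in the center, the inclusion `𝒪_{X,x} → 𝒪_{Y,E}` inside the function field. -/
def stalkHom {x : X} (hx : x ∈ E.center) : X.presheaf.stalk x →+* E.Y.presheaf.stalk E.η :=
  (X.presheaf.stalkSpecializes (specializes_iff_mem_closure.mpr hx) ≫ E.f.stalkMap E.η).hom

/-- The divisorial valuation `ν = ord_E` on the local ring `𝒪_{X,x}` of a point of the center. -/
def val {x : X} (hx : x ∈ E.center) (g : X.presheaf.stalk x) : ℕ∞ :=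
  E.ord (E.stalkHom hx g)

/-- `ν(𝔪_x)`, the minimal value of `ν` on the maximal ideal of `𝒪_{X,x}`. -/
def valMaximalIdeal {x : X} (hx : x ∈ E.center) : ℕ∞ :=
  ⨅ g ∈ IsLocalRing.maximalIdeal (X.presheaf.stalk x), E.val hx g

/-- The discrepancy `a(E; X)` of a divisor `E` over `X` whose center meets the smooth locus of
`X`, i.e. the coefficient of `E` in `K_Y - f^* K_X`. The canonical sheaf `ω_X` is generated near
the generic point of the center by a top form `ω`; then `K_Y - f^* K_X` is near `E` the divisor of
the top form `f^* ω` on `Y`, so that the coefficient is the order of vanishing of `f^* ω`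
along `E`. -/
def discrepancy : ℕ :=
  letI : Algebra ℂ (X.presheaf.stalk E.centerPt) := (stalkStructureMap s E.centerPt).toAlgebra
  letI : Algebra ℂ (E.Y.presheaf.stalk E.η) := (stalkStructureMap (E.f ≫ s) E.η).toAlgebra
  letI : Algebra (X.presheaf.stalk E.centerPt) (E.Y.presheaf.stalk E.η) :=
    (E.f.stalkMap E.η).hom.toAlgebra
  jacobianOrder ℂ (X.presheaf.stalk E.centerPt) (E.Y.presheaf.stalk E.η)

end DivisorOver

end Izumi

end

/-!
The lower bound is formal: `ν` is additive, so an element of `𝔪 ^ n` has value at least `n ν(𝔪)`.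

The upper bound rests on derivations. At a smooth closed point `x` there are coordinates `yᵢ` with
dual derivations `∂ᵢ` (`exists_localCoordinates`), and in characteristic zero an element of order
exactly `n` becomes a unit after `n` applications of a suitable derivation `∑ aᵢ ∂ᵢ` with constant
coefficients, because its leading form does not vanish identically
(`LocalCoordinates.exists_isUnit_dir_iterate`). It remains to see that a derivation `D` lowers `ν`
by at most the discrepancy (`addVal_le_addVal_derivation_add_jacobianOrder`). This is proved in the
local ring at the generic point of the center. Its dimension is at least two, so there is a basis
`dzᵢ` of the differentials in which two of the `zᵢ` vanish on the center. If `ω` is the wedge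
product of the `dzᵢ`, then `∂g/∂zᵢ · f^*ω` is the wedge product with `dzᵢ` replaced by `dg`. It
still contains some `dzⱼ` with `zⱼ` vanishing on `E`. Writing `g = t ^ r u` and `zⱼ = t v` with a
uniformizer `t` of `𝒪_{Y,E}`, the only term of `dg ∧ dzⱼ` which is not visibly divisible by `t ^ r`
is a multiple of `dt ∧ dt = 0` (`ιMulti_mem_pow_smul`). Hence `∂g/∂zᵢ · f^*ω` is divisible by
`t ^ ν(g)`. As `𝒪_{Y,E}` is formally smooth over the ground field
(`formallySmooth_of_isDiscreteValuationRing`), its module of differentials is free, and powers of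
`t` can be cancelled to give `ν(g) ≤ ν(∂g/∂zᵢ) + a(ν)`.

For sharpness on a surface, suppose that `ν` is the order at `x`. Then `ν` has center `x`. The key
estimate, applied to a coordinate and its dual derivation, gives `a(ν) ≥ 1`
(`one_le_jacobianOrder`). Conversely, Euler's formula shows that the derivations
`y₀⁻¹ (y₀ ∂₀ + y₁ ∂₁)` and `y₀ ∂₁` of the function field preserve `𝒪_{Y,E}`. Their determinant on
`dy₀ ∧ dy₁` is `y₀`, of value one, so that `a(ν) ≤ 1` (`pullbackForm_notMem_sq_smul`).

That the order at `x` is divisorial is seen on the blow-up of `x`: its valuation ring is the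
localization of the normalized chart `R₀[𝔪 / a]`, for an `a` of order one, at a prime of height one
(`exists_normal_finiteType_addVal_eq_mult`).
-/

namespace Izumi

open IsLocalRing

/-! ### Derivations and powers of the maximal ideal -/

section Derivation

variable {k R : Type*} [CommRing k] [CommRing R] [Algebra k R]

/-- The Leibniz rule for iterates of a derivation. -/
theorem derivation_iterate_mul (D : Derivation k R R) (n : ℕ) (g h : R) :
    D^[n] (g * h) =
      ∑ ij ∈ Finset.HasAntidiagonal.antidiagonal n,
        n.choose ij.1 • (D^[ij.1] g * D^[ij.2] h) := by
  induction n with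
  | zero => simp
  | succ n ih =>
    rw [Finset.sum_antidiagonal_choose_succ_nsmul
      (M := R) (fun i j => D^[i] g * D^[j] h) n, Function.iterate_succ_apply', ih, map_sum]
    simp only [← Finset.sum_add_distrib, map_nsmul, Derivation.leibniz, smul_add, smul_eq_mul,
      Function.iterate_succ_apply']
    refine Finset.sum_congr rfl fun ij hij => ?_
    rw [mul_comm (D^[ij.2] h),
      ← Nat.choose_symm_of_eq_add (Finset.HasAntidiagonal.mem_antidiagonal.mp hij).symm]

theorem derivation_mem_pow (I : Ideal R) (D : Derivation k R R) (n : ℕ) {g : R}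
    (hg : g ∈ I ^ (n + 1)) : D g ∈ I ^ n := by
  induction n generalizing g with
  | zero => simp
  | succ n ih =>
    rw [pow_succ'] at hg
    refine Submodule.mul_induction_on hg (fun a ha b hb => ?_) fun a b ha hb => ?_
    · rw [D.leibniz, smul_eq_mul, smul_eq_mul]
      refine add_mem ?_ (Ideal.mul_mem_right _ _ hb)
      rw [pow_succ']
      exact Ideal.mul_mem_mul ha (ih hb)
    · rw [map_add]
      exact add_mem ha hb

theorem derivation_iterate_mem_pow (I : Ideal R) (D : Derivation k R R) (n m : ℕ) {g : R}
    (hg : g ∈ I ^ (n + m)) : D^[n] g ∈ I ^ m := by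
  induction n generalizing g with
  | zero => simpa using hg
  | succ n ih =>
    rw [Function.iterate_succ_apply]
    exact ih (derivation_mem_pow I D _ (by rwa [add_right_comm] at hg))

/-- The leading term of the Leibniz rule, modulo `I`, for factors in `I ^ a` and `I ^ b`. -/
theorem derivation_iterate_mul_sub_mem (I : Ideal R) (D : Derivation k R R) (a b : ℕ) {g h : R}
    (hg : g ∈ I ^ a) (hh : h ∈ I ^ b) :
    D^[a + b] (g * h) - (a + b).choose a • (D^[a] g * D^[b] h) ∈ I := by
  rw [derivation_iterate_mul, ← Finset.add_sum_erase _ _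
    (show (a, b) ∈ Finset.HasAntidiagonal.antidiagonal (a + b) by simp), add_sub_cancel_left]
  refine Submodule.sum_mem _ fun ij hij => ?_
  obtain ⟨hne, hij⟩ := Finset.mem_erase.mp hij
  rw [Finset.HasAntidiagonal.mem_antidiagonal] at hij
  refine nsmul_mem ?_ _
  rcases lt_trichotomy ij.1 a with h1 | h1 | h1
  · have := derivation_iterate_mem_pow I D ij.1 (a - ij.1) (by rwa [Nat.add_sub_cancel' h1.le])
    exact Ideal.mul_mem_right _ _ (Ideal.pow_le_self (by lia) this)
  · exact absurd (Prod.ext h1 (by lia)) hne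
  · have := derivation_iterate_mem_pow I D ij.2 (b - ij.2)
      (by rwa [Nat.add_sub_cancel' (by lia)])
    exact Ideal.mul_mem_left _ _ (Ideal.pow_le_self (by lia) this)

end Derivation

/-! ### Local coordinates -/

/-- Local coordinates on a local `k`-algebra `R` with residue field `k`: generators `y i` of the
maximal ideal together with `k`-derivations `∂ i` of `R` such that `∂ i (y j) = δ i j`. -/
structure LocalCoordinates (k R ι : Type*) [Field k] [CommRing R] [IsLocalRing R] [Algebra k R]
    [DecidableEq ι] where
  /-- the coordinate functions -/
  y : ι → R
  /-- the partial derivatives -/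
  partialD : ι → Derivation k R R
  span_y : Ideal.span (Set.range y) = maximalIdeal R
  partialD_y : ∀ i j, partialD i (y j) = if i = j then 1 else 0
  residue : ∀ r : R, ∃ c : k, r - algebraMap k R c ∈ maximalIdeal R

namespace LocalCoordinates

variable {k R ι : Type*} [Field k] [CommRing R] [IsLocalRing R] [Algebra k R]
  [DecidableEq ι] (𝒞 : LocalCoordinates k R ι)

theorem y_mem (i : ι) : 𝒞.y i ∈ maximalIdeal R :=
  𝒞.span_y ▸ Ideal.subset_span ⟨i, rfl⟩

variable [Fintype ι]

/-- The constant vector field `∑ aᵢ ∂ᵢ`. -/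
def dir (a : ι → k) : Derivation k R R := ∑ i, a i • 𝒞.partialD i

theorem dir_y (a : ι → k) (i : ι) : 𝒞.dir a (𝒞.y i) = algebraMap k R (a i) := by
  have : 𝒞.dir a (𝒞.y i) = ∑ j, a j • 𝒞.partialD j (𝒞.y i) := by
    rw [dir, ← Derivation.coeFnAddMonoidHom_apply, map_sum, Finset.sum_apply]
    rfl
  simp [this, 𝒞.partialD_y, Algebra.algebraMap_eq_smul_one]

theorem dir_iterate_y_mul (a : ι → k) (i : ι) (n : ℕ) (g : R) :
    (𝒞.dir a)^[n + 1] (𝒞.y i * g) = 𝒞.y i * (𝒞.dir a)^[n + 1] g +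
      (n + 1 : ℕ) • (algebraMap k R (a i) * (𝒞.dir a)^[n] g) := by
  induction n with
  | zero => simp [dir_y, mul_comm g]
  | succ n ih =>
    rw [Function.iterate_succ_apply', ih, map_add, map_nsmul]
    simp only [Derivation.leibniz, dir_y, smul_eq_mul,
      Derivation.map_algebraMap, Function.iterate_succ_apply', nsmul_eq_mul]
    push_cast
    ring

/-- Every `g ∈ 𝔪 ^ n` has a leading form `P`, a polynomial in the coordinates, whose values are
the `n`-fold derivatives of `g` in constant directions. -/
theorem exists_leadingForm (n : ℕ) {g : R} (hg : g ∈ maximalIdeal R ^ n) :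
    ∃ P : MvPolynomial ι k, g - MvPolynomial.aeval 𝒞.y P ∈ maximalIdeal R ^ (n + 1) ∧
      ∀ a, (𝒞.dir a)^[n] g - algebraMap k R (n.factorial * MvPolynomial.eval a P)
        ∈ maximalIdeal R := by
  induction n generalizing g with
  | zero =>
    obtain ⟨c, hc⟩ := 𝒞.residue g
    exact ⟨MvPolynomial.C c, by simpa using hc, fun a => by simpa using hc⟩
  | succ n ih =>
    rw [pow_succ', ← 𝒞.span_y] at hg
    obtain ⟨f, hf⟩ : ∃ f : ι → R, (∀ i, f i ∈ maximalIdeal R ^ n) ∧ ∑ i, 𝒞.y i * f i = g := by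
      rw [𝒞.span_y] at hg
      have : maximalIdeal R * maximalIdeal R ^ n =
          ⨆ i, Ideal.span {𝒞.y i} * maximalIdeal R ^ n := by
        rw [← Ideal.iSup_mul, ← 𝒞.span_y, Ideal.span_range_eq_iSup]
      rw [this, Submodule.mem_iSup_iff_exists_finsupp] at hg
      obtain ⟨f, hf, rfl⟩ := hg
      choose u hu hu' using fun i => Ideal.mem_span_singleton_mul.mp (hf i)
      refine ⟨u, hu, ?_⟩
      rw [Finsupp.sum_fintype _ _ (by simp)]
      simp [hu']
    obtain ⟨hf, rfl⟩ := hf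
    choose P hP hP' using fun i => ih (hf i)
    refine ⟨∑ i, MvPolynomial.X i * P i, ?_, fun a => ?_⟩
    · rw [map_sum, ← Finset.sum_sub_distrib]
      refine Submodule.sum_mem _ fun i _ => ?_
      rw [map_mul, MvPolynomial.aeval_X, ← mul_sub, pow_succ']
      exact Ideal.mul_mem_mul (𝒞.y_mem i) (hP i)
    · rw [map_sum, Finset.mul_sum, map_sum]
      have : (𝒞.dir a)^[n + 1] (∑ i, 𝒞.y i * f i) = ∑ i, (𝒞.dir a)^[n + 1] (𝒞.y i * f i) := by
        have : ⇑(𝒞.dir a) = ⇑(𝒞.dir a : R →ₗ[k] R) := rfl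
        rw [this, ← Module.End.coe_pow, map_sum]
      rw [this, ← Finset.sum_sub_distrib]
      refine Submodule.sum_mem _ fun i _ => ?_
      rw [dir_iterate_y_mul]
      convert! add_mem (Ideal.mul_mem_right ((𝒞.dir a)^[n + 1] (f i)) _ (𝒞.y_mem i))
        (Ideal.mul_mem_left _ ((n + 1 : ℕ) * algebraMap k R (a i)) (hP' i a)) using 1
      simp only [map_mul, MvPolynomial.eval_X, Nat.factorial_succ, Nat.cast_mul, map_natCast,
        nsmul_eq_mul]
      push_cast
      ring

variable [CharZero k]

/-- A nonvanishing leading form is detected by derivatives in a constant direction, so that an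
element of order exactly `n` becomes a unit after applying some derivation `n` times. -/
theorem exists_isUnit_dir_iterate {n : ℕ} {g : R} (hg : g ∈ maximalIdeal R ^ n)
    (hg' : g ∉ maximalIdeal R ^ (n + 1)) : ∃ a, IsUnit ((𝒞.dir a)^[n] g) := by
  obtain ⟨P, hP, hP'⟩ := 𝒞.exists_leadingForm n hg
  have hP0 : P ≠ 0 := by
    rintro rfl
    exact hg' (by simpa using hP)
  obtain ⟨a, ha⟩ : ∃ a, MvPolynomial.eval a P ≠ 0 := by
    by_contra! h
    exact hP0 (MvPolynomial.funext fun a => by simpa using h a)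
  refine ⟨a, ?_⟩
  have hu : IsUnit (algebraMap k R (n.factorial * MvPolynomial.eval a P)) :=
    (IsUnit.mk0 _ (mul_ne_zero (by exact_mod_cast n.factorial_ne_zero) ha)).map _
  by_contra hn
  exact (mem_maximalIdeal _).mp ((Submodule.sub_mem_iff_right _ hn).mp (hP' a)) hu

/-- The associated graded ring of `R` has no zero divisors. -/
theorem mul_notMem_pow (𝒞 : LocalCoordinates k R ι) {m n : ℕ} {g h : R}
    (hg : g ∈ maximalIdeal R ^ m) (hg' : g ∉ maximalIdeal R ^ (m + 1)) (hh : h ∈ maximalIdeal R ^ n)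
    (hh' : h ∉ maximalIdeal R ^ (n + 1)) : g * h ∉ maximalIdeal R ^ (m + n + 1) := by
  intro hgh
  obtain ⟨P, hP, hP'⟩ := 𝒞.exists_leadingForm m hg
  obtain ⟨Q, hQ, hQ'⟩ := 𝒞.exists_leadingForm n hh
  have hP0 : P ≠ 0 := by
    rintro rfl
    exact hg' (by simpa using hP)
  have hQ0 : Q ≠ 0 := by
    rintro rfl
    exact hh' (by simpa using hQ)
  obtain ⟨a, ha⟩ : ∃ a, MvPolynomial.eval a (P * Q) ≠ 0 := by
    by_contra! h
    exact mul_ne_zero hP0 hQ0 (MvPolynomial.funext fun a => by simpa using h a)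
  rw [map_mul] at ha
  have aux : ∀ (l : ℕ) (f : R) (F : MvPolynomial ι k), MvPolynomial.eval a F ≠ 0 →
      (𝒞.dir a)^[l] f - algebraMap k R (l.factorial * MvPolynomial.eval a F) ∈ maximalIdeal R →
      IsUnit ((𝒞.dir a)^[l] f) := fun l f F hF hf => by
    have hu : IsUnit (algebraMap k R (l.factorial * MvPolynomial.eval a F)) :=
      (IsUnit.mk0 _ (mul_ne_zero (by exact_mod_cast l.factorial_ne_zero) hF)).map _
    by_contra hn
    exact (mem_maximalIdeal _).mp ((Submodule.sub_mem_iff_right _ hn).mp hf) hu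
  have h1 := aux m g P (left_ne_zero_of_mul ha) (hP' a)
  have h2 := aux n h Q (right_ne_zero_of_mul ha) (hQ' a)
  have h3 := derivation_iterate_mul_sub_mem (maximalIdeal R) (𝒞.dir a) m n hg hh
  have h4 := derivation_iterate_mem_pow (maximalIdeal R) (𝒞.dir a) (m + n) 1 hgh
  rw [pow_one] at h4
  have h5 := (Submodule.sub_mem_iff_right _ h4).mp h3
  refine (mem_maximalIdeal _).mp h5 ?_
  rw [nsmul_eq_mul]
  refine IsUnit.mul ?_ (h1.mul h2)
  rw [← map_natCast (algebraMap k R)]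
  exact (IsUnit.mk0 _ (by exact_mod_cast
    (Nat.choose_pos (Nat.le_add_right m n)).ne')).map _

end LocalCoordinates

/-! ### The order of an element -/

section Order

variable {R : Type*} [CommRing R] [IsLocalRing R]

theorem le_mult_iff {g : R} {n : ℕ} : (n : ℕ∞) ≤ mult R g ↔ g ∈ maximalIdeal R ^ n := by
  refine ⟨fun h => ?_, fun h => le_iSup₂_of_le n h le_rfl⟩
  cases n with
  | zero => simp
  | succ n =>
    by_contra hg
    refine absurd h (not_le.mpr
      (lt_of_le_of_lt (b := (n : ℕ∞)) ?_ (by exact_mod_cast n.lt_succ_self)))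
    refine iSup₂_le fun k hk => ?_
    by_contra! hnk
    exact hg (Ideal.pow_le_pow_right (by exact_mod_cast hnk) hk)

theorem mult_eq_iff {g : R} {n : ℕ} :
    mult R g = n ↔ g ∈ maximalIdeal R ^ n ∧ g ∉ maximalIdeal R ^ (n + 1) := by
  rw [← le_mult_iff, ← le_mult_iff, not_le, Nat.cast_add_one, ENat.lt_add_one_iff (by simp),
    and_comm, le_antisymm_iff]

theorem mult_zero : mult R (0 : R) = ⊤ :=
  ENat.eq_top_iff_forall_ge.mpr fun _ => le_mult_iff.mpr (zero_mem _)

theorem mult_eq_top_iff [IsNoetherianRing R] {g : R} : mult R g = ⊤ ↔ g = 0 := by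
  refine ⟨fun h => ?_, fun h => h ▸ mult_zero⟩
  have : g ∈ ⨅ i, maximalIdeal R ^ i :=
    (Submodule.mem_iInf _).mpr fun i => le_mult_iff.mp (by simp [h])
  rwa [Ideal.iInf_pow_eq_bot_of_isLocalRing _ (maximalIdeal.isMaximal R).ne_top] at this

theorem mult_add (g h : R) : min (mult R g) (mult R h) ≤ mult R (g + h) := by
  refine ENat.forall_natCast_le_iff_le.mp fun _ hn => le_mult_iff.mpr ?_
  rw [le_min_iff, le_mult_iff, le_mult_iff] at hn
  exact add_mem hn.1 hn.2

/-- The order is additive on products because the associated graded ring has no zero divisors. -/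
theorem LocalCoordinates.mult_mul {k ι : Type*} [Field k] [CharZero k] [Algebra k R] [Fintype ι]
    [DecidableEq ι] [IsNoetherianRing R] (𝒞 : LocalCoordinates k R ι) (g h : R) :
    mult R (g * h) = mult R g + mult R h := by
  by_cases hg : g = 0
  · simp [hg, mult_zero]
  by_cases hh : h = 0
  · simp [hh, mult_zero]
  obtain ⟨m, hm⟩ := ENat.ne_top_iff_exists.mp (mt mult_eq_top_iff.mp hg)
  obtain ⟨n, hn⟩ := ENat.ne_top_iff_exists.mp (mt mult_eq_top_iff.mp hh)
  rw [← hm, ← hn, ← Nat.cast_add, mult_eq_iff, pow_add]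
  obtain ⟨h1, h2⟩ := mult_eq_iff.mp hm.symm
  obtain ⟨h3, h4⟩ := mult_eq_iff.mp hn.symm
  exact ⟨Ideal.mul_mem_mul h1 h3, 𝒞.mul_notMem_pow h1 h2 h3 h4⟩

theorem LocalCoordinates.isDomain {k ι : Type*} [Field k] [CharZero k] [Algebra k R] [Fintype ι]
    [DecidableEq ι] [IsNoetherianRing R] (𝒞 : LocalCoordinates k R ι) : IsDomain R := by
  have : NoZeroDivisors R := ⟨fun {g h} hgh => by
    rw [← mult_eq_top_iff, 𝒞.mult_mul] at hgh
    simpa [mult_eq_top_iff] using hgh⟩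
  exact NoZeroDivisors.to_isDomain R

end Order

/-! ### The number of local coordinates -/

/-- The derivation induced on the quotient by an ideal preserved by `D`. -/
def quotientDerivation {k R : Type*} [CommRing k] [CommRing R] [Algebra k R] (I : Ideal R)
    (D : Derivation k R R) (hD : ∀ r ∈ I, D r ∈ I) : Derivation k (R ⧸ I) (R ⧸ I) :=
  Derivation.mk' ((I.restrictScalars k).mapQ (I.restrictScalars k) (D : R →ₗ[k] R) hD)
    (by
      intro a b
      obtain ⟨a, rfl⟩ := Ideal.Quotient.mk_surjective a
      obtain ⟨b, rfl⟩ := Ideal.Quotient.mk_surjective b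
      change Ideal.Quotient.mk I (D (a * b)) = Ideal.Quotient.mk I a * Ideal.Quotient.mk I (D b) +
        Ideal.Quotient.mk I b * Ideal.Quotient.mk I (D a)
      rw [D.leibniz]
      simp)

theorem quotientDerivation_mk {k R : Type*} [CommRing k] [CommRing R] [Algebra k R] (I : Ideal R)
    (D : Derivation k R R) (hD : ∀ r ∈ I, D r ∈ I) (r : R) :
    quotientDerivation I D hD (Ideal.Quotient.mk I r) = Ideal.Quotient.mk I (D r) := rfl

/-- The number of local coordinates is at most the Krull dimension: dividing out one coordinate
leaves a ring with one coordinate less, and lowers the dimension because `R` is a domain. -/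
theorem LocalCoordinates.le_ringKrullDim {k R : Type*} [Field k] [CharZero k] [CommRing R]
    [IsLocalRing R] [IsNoetherianRing R] [Algebra k R] {n : ℕ}
    (𝒞 : LocalCoordinates k R (Fin n)) : (n : WithBot ℕ∞) ≤ ringKrullDim R := by
  induction n generalizing R with
  | zero => simpa using ringKrullDim_nonneg_of_nontrivial
  | succ n ih =>
    have : IsDomain R := 𝒞.isDomain
    set I := Ideal.span {𝒞.y 0} with hI
    have hIm : I ≤ maximalIdeal R := by
      rw [hI, Ideal.span_singleton_le_iff_mem]
      exact 𝒞.y_mem 0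
    have : Nontrivial (R ⧸ I) := Ideal.Quotient.nontrivial_iff.mpr
      (ne_top_of_le_ne_top (maximalIdeal.isMaximal R).ne_top hIm)
    have : IsLocalRing (R ⧸ I) := .of_surjective' _ Ideal.Quotient.mk_surjective
    have hmap : (maximalIdeal R).map (Ideal.Quotient.mk I) = maximalIdeal (R ⧸ I) :=
      map_maximalIdeal_of_surjective _ Ideal.Quotient.mk_surjective
    have hD : ∀ i : Fin n, ∀ r ∈ I, 𝒞.partialD i.succ r ∈ I := by
      intro i r hr
      obtain ⟨c, rfl⟩ := Ideal.mem_span_singleton'.mp hr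
      rw [Derivation.leibniz, 𝒞.partialD_y, if_neg (Fin.succ_ne_zero i), smul_zero, zero_add]
      exact Ideal.mul_mem_right _ _ (Ideal.mem_span_singleton_self _)
    let 𝒞' : LocalCoordinates k (R ⧸ I) (Fin n) :=
      { y := fun i => Ideal.Quotient.mk I (𝒞.y i.succ)
        partialD := fun i => quotientDerivation I _ (hD i)
        span_y := by
          rw [← hmap, ← 𝒞.span_y, Ideal.map_span, ← Set.range_comp]
          refine le_antisymm (Ideal.span_mono ?_) (Ideal.span_le.mpr ?_)
          · rintro _ ⟨i, rfl⟩
            exact ⟨i.succ, rfl⟩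
          · rintro _ ⟨i, rfl⟩
            refine Fin.cases ?_ (fun i => ?_) i
            · rw [Function.comp_apply,
                Ideal.Quotient.eq_zero_iff_mem.mpr (Ideal.mem_span_singleton_self _)]
              exact zero_mem _
            · exact Ideal.subset_span ⟨i, rfl⟩
        partialD_y := fun i j => by
          rw [quotientDerivation_mk, 𝒞.partialD_y]
          simp only [Fin.succ_inj]
          split_ifs <;> simp
        residue := fun r => by
          obtain ⟨r, rfl⟩ := Ideal.Quotient.mk_surjective r
          obtain ⟨c, hc⟩ := 𝒞.residue r
          exact ⟨c, hmap ▸ by simpa using Ideal.mem_map_of_mem (Ideal.Quotient.mk I) hc⟩ }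
    have h0 : 𝒞.y 0 ≠ 0 := fun h => by
      have := 𝒞.partialD_y 0 0
      rw [h, map_zero, if_pos rfl] at this
      exact zero_ne_one this
    calc ((n + 1 : ℕ) : WithBot ℕ∞) = n + 1 := by push_cast; rfl
      _ ≤ ringKrullDim (R ⧸ I) + 1 := by gcongr; exact ih 𝒞'
      _ ≤ ringKrullDim R :=
        ringKrullDim_quotient_succ_le_of_nonZeroDivisor (mem_nonZeroDivisors_of_ne_zero h0)

/-- At a regular point of dimension `d` there are exactly `d` local coordinates, since the maximal
ideal of a local ring of dimension `d` needs at least `d` generators. -/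
theorem LocalCoordinates.finrank_eq {k R : Type*} [Field k] [CharZero k] [CommRing R]
    [IsLocalRing R] [IsNoetherianRing R] [Algebra k R] {n d : ℕ}
    (𝒞 : LocalCoordinates k R (Fin n)) (hd : ringKrullDim R = d) : n = d := by
  apply le_antisymm
  · exact_mod_cast hd ▸ 𝒞.le_ringKrullDim
  · have h1 := ringKrullDim_le_spanFinrank_maximalIdeal R
    rw [hd, ← 𝒞.span_y] at h1
    have h2 := Submodule.spanFinrank_span_le_ncard_of_finite (R := R) (Set.finite_range 𝒞.y)
    have h3 : (Set.range 𝒞.y).ncard ≤ n := by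
      rw [← Set.image_univ]
      exact (Set.ncard_image_le).trans (by simp)
    exact (by exact_mod_cast h1 : d ≤ _).trans (h2.trans h3)

end Izumi

namespace Izumi

open IsLocalRing TensorProduct

/-! ### Bases of differentials over smooth local rings -/

section Smooth

variable {k A : Type*} [Field k] [CommRing A] [IsLocalRing A] [Algebra k A]

/-- On the maximal ideal, `d` is linear over the residue field modulo `𝔪 Ω`. -/
theorem tmul_D_mul {a : A} (ha : a ∈ maximalIdeal A) (r : A) :
    (1 : ResidueField A) ⊗ₜ[A] KaehlerDifferential.D k A (r * a) =
      residue A r • ((1 : ResidueField A) ⊗ₜ[A] KaehlerDifferential.D k A a) := by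
  have h1 : algebraMap A (ResidueField A) a = 0 := (residue_eq_zero_iff a).mpr ha
  rw [Derivation.leibniz, tmul_add, tmul_smul, tmul_smul, smul_tmul', smul_tmul',
    Algebra.smul_def a, h1, zero_mul, zero_tmul, add_zero, smul_tmul', Algebra.smul_def]
  rfl

theorem span_tmul_D :
    Submodule.span (ResidueField A)
      (Set.range fun a : A => (1 : ResidueField A) ⊗ₜ[A] KaehlerDifferential.D k A a) = ⊤ := by
  have h := congr_arg (Submodule.baseChange (ResidueField A))
    (KaehlerDifferential.span_range_derivation k A)
  rw [Submodule.baseChange_span, Submodule.baseChange_top, ← Set.range_comp] at h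
  exact h

variable [Algebra.EssFiniteType k A] [Algebra.FormallySmooth k A]

/-- A linearly independent family of differentials modulo `𝔪`, inside a generating family,
extends to a basis of `Ω`. -/
theorem exists_basis_D {S s : Set A}
    (hS : Submodule.span (ResidueField A)
      ((fun a : A => (1 : ResidueField A) ⊗ₜ[A] KaehlerDifferential.D k A a) '' S) = ⊤)
    (hsS : s ⊆ S) (hs : LinearIndepOn (ResidueField A)
      (fun a : A => (1 : ResidueField A) ⊗ₜ[A] KaehlerDifferential.D k A a) s) :
    ∃ (z : Fin (Module.finrank A Ω[A⁄k]) → A)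
      (b : Module.Basis (Fin (Module.finrank A Ω[A⁄k])) A Ω[A⁄k]),
      (∀ i, b i = KaehlerDifferential.D k A (z i)) ∧ (∀ i, z i ∈ S) ∧ s ⊆ Set.range z := by
  have hspan := hs.image_subset_span_image_extend hsS
  obtain ⟨b, hb⟩ := Module.exists_basis_of_basis_baseChange
    (fun a : hs.extend hsS => KaehlerDifferential.D k A a.1) (hs.linearIndepOn_extend hsS)
    (by
      rw [eq_top_iff, ← hS, Submodule.span_le]
      refine hspan.trans (Submodule.span_mono ?_)
      rintro _ ⟨a, ha, rfl⟩
      exact ⟨⟨a, ha⟩, rfl⟩)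
    (Module.Flat.rTensor_preserves_injective_linearMap _ Subtype.val_injective)
  have : Finite (hs.extend hsS) := Module.Finite.finite_basis b
  let := Fintype.ofFinite (hs.extend hsS)
  let e : hs.extend hsS ≃ Fin (Module.finrank A Ω[A⁄k]) :=
    Fintype.equivFinOfCardEq (Module.finrank_eq_card_basis b).symm
  refine ⟨fun i => (e.symm i).1, b.reindex e, fun i => ?_, fun i => ?_, fun a ha => ?_⟩
  · rw [Module.Basis.reindex_apply, hb]
  · exact hs.extend_subset hsS (e.symm i).2
  · exact ⟨e ⟨a, hs.subset_extend hsS ha⟩, by simp⟩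

variable [CharZero k]

/-- On the maximal ideal, the differential is injective modulo `𝔪²`, because the residue field is
formally smooth over `k`. -/
theorem mem_sq_of_tmul_D_eq_zero {a : A} (ha : a ∈ maximalIdeal A)
    (h : (1 : ResidueField A) ⊗ₜ[A] KaehlerDifferential.D k A a = 0) :
    a ∈ maximalIdeal A ^ 2 := by
  have : Algebra.EssFiniteType k (ResidueField A) :=
    .of_surjective (IsScalarTower.toAlgHom k A (ResidueField A)) residue_surjective
  have hs : Function.Surjective (algebraMap A (ResidueField A)) := residue_surjective
  obtain ⟨l, hl⟩ := (Algebra.FormallySmooth.iff_split_injection (R := k) hs).mp inferInstance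
  have hinj : Function.Injective (KaehlerDifferential.kerCotangentToTensor k A (ResidueField A)) :=
    Function.LeftInverse.injective (g := l) (DFunLike.congr_fun hl)
  have hker : RingHom.ker (algebraMap A (ResidueField A)) = maximalIdeal A := ker_residue
  have ha' : a ∈ RingHom.ker (algebraMap A (ResidueField A)) := hker ▸ ha
  have h0 := hinj.eq_iff' (map_zero _) |>.mp
    (show KaehlerDifferential.kerCotangentToTensor k A (ResidueField A)
      (Ideal.toCotangent _ ⟨a, ha'⟩) = 0 from h)
  rw [Ideal.toCotangent_eq_zero] at h0
  rwa [← hker]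

/-- In dimension at least two there is a basis of differentials containing the differentials of
two elements of the maximal ideal. -/
theorem exists_basis_D_of_two_le_ringKrullDim [IsNoetherianRing A] (hA : 2 ≤ ringKrullDim A) :
    ∃ (z : Fin (Module.finrank A Ω[A⁄k]) → A)
      (b : Module.Basis (Fin (Module.finrank A Ω[A⁄k])) A Ω[A⁄k]),
      (∀ i, b i = KaehlerDifferential.D k A (z i)) ∧
      ∃ i j, i ≠ j ∧ z i ∈ maximalIdeal A ∧ z j ∈ maximalIdeal A := by
  have hdim : 1 < Module.finrank (ResidueField A) (CotangentSpace A) := by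
    rw [← spanFinrank_maximalIdeal_eq_finrank_cotangentSpace]
    have h := hA.trans (ringKrullDim_le_spanFinrank_maximalIdeal A)
    exact_mod_cast h
  have := Module.nontrivial_of_finrank_pos (hdim.le : 0 < _)
  obtain ⟨c₀, hc₀⟩ := exists_ne (0 : CotangentSpace A)
  obtain ⟨c₁, hc₁⟩ := exists_linearIndependent_pair_of_one_lt_finrank hdim hc₀
  obtain ⟨⟨a₀, ha₀⟩, rfl⟩ := Ideal.toCotangent_surjective _ c₀
  obtain ⟨⟨a₁, ha₁⟩, rfl⟩ := Ideal.toCotangent_surjective _ c₁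
  have hli : LinearIndependent (ResidueField A)
      ![(1 : ResidueField A) ⊗ₜ[A] KaehlerDifferential.D k A a₀,
        (1 : ResidueField A) ⊗ₜ[A] KaehlerDifferential.D k A a₁] := by
    rw [LinearIndependent.pair_iff] at hc₁ ⊢
    intro s t hst
    obtain ⟨s, rfl⟩ := residue_surjective s
    obtain ⟨t, rfl⟩ := residue_surjective t
    refine hc₁ _ _ ?_
    rw [← tmul_D_mul ha₀, ← tmul_D_mul ha₁, ← tmul_add, ← map_add] at hst
    have h := mem_sq_of_tmul_D_eq_zero
      (add_mem (Ideal.mul_mem_left _ s ha₀) (Ideal.mul_mem_left _ t ha₁)) hst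
    exact (Ideal.toCotangent_eq_zero _
      (s • (⟨a₀, ha₀⟩ : maximalIdeal A) + t • (⟨a₁, ha₁⟩ : maximalIdeal A))).mpr h
  have hne : a₀ ≠ a₁ := by
    rintro rfl
    exact absurd (hli.injective.eq_iff (a := 0) (b := 1)).mp (by simp)
  have hs : LinearIndepOn (ResidueField A)
      (fun a : A => (1 : ResidueField A) ⊗ₜ[A] KaehlerDifferential.D k A a) {a₀, a₁} :=
    (LinearIndepOn.pair_iff _ hne).mpr (LinearIndependent.pair_iff.mp hli)
  obtain ⟨z, b, hb, -, hz⟩ := exists_basis_D (S := Set.univ)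
    (by rw [Set.image_univ]; exact span_tmul_D) (Set.subset_univ _) hs
  obtain ⟨i, hi⟩ := hz (Set.mem_insert _ _)
  obtain ⟨j, hj⟩ := hz (Set.mem_insert_of_mem _ rfl)
  exact ⟨z, b, hb, i, j, fun h => hne (by rw [← hi, ← hj, h]), hi ▸ ha₀, hj ▸ ha₁⟩

/-- A smooth local algebra with residue field `k` has local coordinates, whose differentials form
a basis of `Ω`. -/
theorem exists_localCoordinates [IsNoetherianRing A]
    (hres : ∀ r : A, ∃ c : k, r - algebraMap k A c ∈ maximalIdeal A) :
    ∃ (𝒞 : LocalCoordinates k A (Fin (Module.finrank A Ω[A⁄k])))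
      (b : Module.Basis (Fin (Module.finrank A Ω[A⁄k])) A Ω[A⁄k]),
      ∀ i, b i = KaehlerDifferential.D k A (𝒞.y i) := by
  obtain ⟨z, b, hb, hz, -⟩ := exists_basis_D (k := k) (S := (maximalIdeal A : Set A)) (s := ∅)
    (by
      rw [eq_top_iff, ← span_tmul_D (k := k), Submodule.span_le]
      rintro _ ⟨a, rfl⟩
      obtain ⟨c, hc⟩ := hres a
      refine Submodule.subset_span ⟨_, hc, ?_⟩
      simp)
    (Set.empty_subset _) (linearIndepOn_empty _ _)
  have hspan : Ideal.span (Set.range z) = maximalIdeal A := by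
    refine le_antisymm (Ideal.span_le.mpr (Set.range_subset_iff.mpr hz)) ?_
    refine Submodule.le_of_le_smul_of_le_jacobson_bot
      (I := maximalIdeal A) (IsNoetherian.noetherian _)
      (IsLocalRing.jacobson_eq_maximalIdeal (⊥ : Ideal A) bot_ne_top).ge fun a ha => ?_
    have hsum : a - ∑ i, b.repr (KaehlerDifferential.D k A a) i * z i ∈ maximalIdeal A ^ 2 := by
      refine mem_sq_of_tmul_D_eq_zero (k := k)
        (sub_mem ha (Submodule.sum_mem _ fun i _ => Ideal.mul_mem_left _ _ (hz i))) ?_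
      rw [map_sub, map_sum, tmul_sub, tmul_sum, sub_eq_zero]
      conv_lhs => rw [← b.sum_repr (KaehlerDifferential.D k A a), tmul_sum]
      refine Finset.sum_congr rfl fun i _ => ?_
      rw [tmul_D_mul (hz i), hb, tmul_smul, ← algebraMap_smul (ResidueField A)]
      rfl
    rw [smul_eq_mul, ← pow_two, ← sub_add_cancel a]
    rw [sup_comm]
    exact Submodule.add_mem_sup hsum (Submodule.sum_mem _ fun i _ =>
      Ideal.mul_mem_left _ _ (Ideal.subset_span ⟨i, rfl⟩))
  exact ⟨{
    y := z
    partialD := fun i => (b.coord i).compDer (KaehlerDifferential.D k A)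
    span_y := hspan
    partialD_y := fun i j => by
      simp [← hb, Finsupp.single_apply, eq_comm]
    residue := hres }, b, hb⟩

end Smooth

end Izumi

namespace Izumi

open IsLocalRing TensorProduct

/-! ### Smoothness of discrete valuation rings in characteristic zero -/

/-- An essentially finite local algebra over a discrete valuation ring which is torsion free and
has a uniformizer of the base as a uniformizer is formally smooth if the residue field of the
base is perfect: it is flat, and its special fibre is a field. -/
theorem formallySmooth_of_map_maximalIdeal_eq {P B : Type*} [CommRing P] [IsDomain P]
    [IsDiscreteValuationRing P] [CommRing B] [IsLocalRing B] [IsDomain B] [Algebra P B]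
    [Algebra.EssFiniteType P B] [IsLocalHom (algebraMap P B)]
    (hinj : Function.Injective (algebraMap P B))
    (hm : (maximalIdeal P).map (algebraMap P B) = maximalIdeal B)
    [PerfectField (ResidueField P)] : Algebra.FormallySmooth P B := by
  have : FaithfulSMul P B := (faithfulSMul_iff_algebraMap_injective P B).mpr hinj
  have : Module.IsTorsionFree P B := inferInstance
  have : Module.Flat P B := inferInstance
  have hmax : ((maximalIdeal P).map (algebraMap P B)).IsMaximal := hm ▸ inferInstance
  have : Algebra.FormallySmooth (ResidueField P) (ResidueField P ⊗[P] B) := by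
    let : Algebra (ResidueField P) (B ⧸ (maximalIdeal P).map (algebraMap P B)) :=
      inferInstanceAs (Algebra (P ⧸ maximalIdeal P) _)
    have : Algebra.FormallySmooth (ResidueField P)
        (B ⧸ (maximalIdeal P).map (algebraMap P B)) :=
      let := Ideal.Quotient.field ((maximalIdeal P).map (algebraMap P B))
      have : Algebra.EssFiniteType (ResidueField P)
        (B ⧸ (maximalIdeal P).map (algebraMap P B)) := Algebra.EssFiniteType.quotient_map ..
      Algebra.FormallySmooth.of_perfectField
    let e : (B ⧸ (maximalIdeal P).map (algebraMap P B)) ≃ₐ[ResidueField P]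
        ResidueField P ⊗[P] B :=
      Algebra.TensorProduct.quotIdealMapEquivQuotTensor B (maximalIdeal P)
    exact .of_equiv e
  have : Algebra.FinitePresentation P (Algebra.EssFiniteType.subalgebra P B) :=
    Algebra.FinitePresentation.of_finiteType.mp inferInstance
  exact Algebra.FormallySmooth.of_formallySmooth_residueField_tensor
    (Algebra.EssFiniteType.submonoid P B)

variable {k B : Type*} [Field k] [CharZero k] [CommRing B] [IsDomain B]
  [IsDiscreteValuationRing B] [Algebra k B] [Algebra.EssFiniteType k B]

/-- A discrete valuation ring essentially of finite type over a field `k` of characteristic zero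
is formally smooth over `k`: it is formally smooth over `k[X]` localized at the origin, where `X`
maps to a uniformizer. -/
theorem formallySmooth_of_isDiscreteValuationRing : Algebra.FormallySmooth k B := by
  obtain ⟨t, ht⟩ := IsDiscreteValuationRing.exists_irreducible B
  have htm : t ∈ maximalIdeal B := (mem_maximalIdeal t).mpr ht.not_isUnit
  let p : Ideal (Polynomial k) := Ideal.span {Polynomial.X}
  have hp : p.IsPrime := (Ideal.span_singleton_prime Polynomial.X_ne_zero).mpr Polynomial.prime_X
  have hp0 : p ≠ ⊥ := by simp [p]
  let P := Localization.AtPrime p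
  have : IsDiscreteValuationRing P :=
    IsLocalization.AtPrime.isDiscreteValuationRing_of_dedekind_domain _ hp0 P
  have hunit : ∀ f : p.primeCompl, IsUnit (Polynomial.aeval (R := k) t f.1) := fun f => by
    have h0 : f.1.coeff 0 ≠ 0 := fun h =>
      f.2 (Ideal.mem_span_singleton.mpr (Polynomial.X_dvd_iff.mpr h))
    have h1 : Polynomial.aeval t f.1 - algebraMap k B (f.1.coeff 0) ∈ maximalIdeal B := by
      have h2 := congr_arg (Polynomial.aeval (R := k) t) (Polynomial.divX_mul_X_add f.1)
      rw [map_add, map_mul, Polynomial.aeval_X, Polynomial.aeval_C] at h2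
      rw [← h2, add_sub_cancel_right]
      exact Ideal.mul_mem_left _ _ htm
    by_contra hn
    exact (mem_maximalIdeal _).mp ((Submodule.sub_mem_iff_right _ hn).mp h1)
      ((IsUnit.mk0 _ h0).map _)
  let φ : P →ₐ[k] B := IsLocalization.liftAlgHom (M := p.primeCompl)
    (f := Polynomial.aeval (R := k) t) hunit
  algebraize [φ.toRingHom]
  have hφ : ∀ x, algebraMap P B x = φ x := fun _ => rfl
  have : IsScalarTower k P B := .of_algebraMap_eq' φ.comp_algebraMap.symm
  have hφX : φ (algebraMap (Polynomial k) P Polynomial.X) = t := by simp [φ]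
  have hmP : maximalIdeal P = Ideal.span {algebraMap (Polynomial k) P Polynomial.X} := by
    rw [← IsLocalization.AtPrime.map_eq_maximalIdeal p P, Ideal.map_span, Set.image_singleton]
  have hm : (maximalIdeal P).map (algebraMap P B) = maximalIdeal B := by
    rw [hmP, Ideal.map_span, Set.image_singleton, hφ, hφX, ht.maximalIdeal_eq]
  have : IsLocalHom (algebraMap P B) :=
    ((local_hom_TFAE (algebraMap P B)).out 0 2 rfl rfl).mpr hm.le
  have hinj : Function.Injective (algebraMap P B) := by
    rw [injective_iff_map_eq_zero]
    intro x hx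
    by_contra hx0
    obtain ⟨n, u, rfl⟩ := IsDiscreteValuationRing.eq_unit_mul_pow_irreducible hx0
      ((IsDiscreteValuationRing.irreducible_iff_uniformizer _).mpr hmP)
    rw [hφ, map_mul, map_pow, hφX] at hx
    exact mul_ne_zero ((u.isUnit.map φ).ne_zero) (pow_ne_zero _ ht.ne_zero) hx
  have : Algebra.EssFiniteType P B := .of_comp k P B
  have : CharZero (ResidueField P) := charZero_of_injective_algebraMap
    (algebraMap k (ResidueField P)).injective
  have : Algebra.FormallySmooth P B := formallySmooth_of_map_maximalIdeal_eq hinj hm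
  have : Algebra.FormallySmooth (Polynomial k) P := .of_isLocalization p.primeCompl
  have : Algebra.FormallySmooth k P := .comp k (Polynomial k) P
  exact .comp k P B

end Izumi

namespace Izumi

open IsLocalRing TensorProduct

/-! ### Pull-back of top forms to a discrete valuation ring -/

/-- The alternating form `(v₁, …, vₙ) ↦ det (ℓ j (v i))` with values in a `B`-algebra `L`. -/
def detForm {B L M : Type*} [CommRing B] [CommRing L] [Algebra B L] [AddCommGroup M] [Module B M]
    {n : ℕ} (ℓ : Fin n → M →ₗ[B] L) : M [⋀^Fin n]→ₗ[B] L :=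
  { ((Matrix.detRowAlternating (n := Fin n) (R := L)).toMultilinearMap.restrictScalars
      B).compLinearMap fun _ => LinearMap.pi ℓ with
    map_eq_zero_of_eq' := fun v i j h hij =>
      Matrix.det_zero_of_row_eq hij (by ext l; exact congr_arg (ℓ l) h) }

theorem detForm_apply {B L M : Type*} [CommRing B] [CommRing L] [Algebra B L] [AddCommGroup M]
    [Module B M] {n : ℕ} (ℓ : Fin n → M →ₗ[B] L) (v : Fin n → M) :
    detForm ℓ v = (Matrix.of fun i j => ℓ j (v i)).det := rfl

/-- An alternating form of degree `n` transforms by the determinant under linear substitutions. -/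
theorem alternatingMap_sum_smul {B M N : Type*} [CommRing B] [AddCommGroup M] [Module B M]
    [AddCommGroup N] [Module B N] {n : ℕ} (F : M [⋀^Fin n]→ₗ[B] N) (v : Fin n → M)
    (c : Matrix (Fin n) (Fin n) B) :
    F (fun i => ∑ j, c i j • v j) = c.det • F v := by
  let ℓ : (Fin n → B) →ₗ[B] M := Fintype.linearCombination B v
  have h : F.compLinearMap ℓ =
      (LinearMap.toSpanSingleton B N (F v)).compAlternatingMap Matrix.detRowAlternating := by
    refine (Pi.basisFun B (Fin n)).ext_alternating fun σ hσ => ?_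
    let τ : Equiv.Perm (Fin n) := Equiv.ofBijective σ (Finite.injective_iff_bijective.mp hσ)
    have h1 : (fun i => Pi.basisFun B (Fin n) (σ i)) = (Pi.basisFun B (Fin n)) ∘ τ := rfl
    rw [h1, AlternatingMap.map_perm, AlternatingMap.map_perm]
    congr 1
    have h2 : Matrix.detRowAlternating (Pi.basisFun B (Fin n)) = 1 := by
      have : (Pi.basisFun B (Fin n) : Fin n → Fin n → B) = (1 : Matrix (Fin n) (Fin n) B) := by
        ext i j
        simp [Matrix.one_apply, Pi.single_apply, eq_comm]
      rw [this]
      exact Matrix.det_one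
    rw [LinearMap.compAlternatingMap_apply, h2, LinearMap.toSpanSingleton_apply, one_smul,
      AlternatingMap.compLinearMap_apply]
    congr 1
    ext i
    simp [ℓ, Fintype.linearCombination_apply]
  exact DFunLike.congr_fun h c

section Forms

variable {k A B : Type*} [CommRing k] [CommRing A] [CommRing B] [Algebra k A]
  [Algebra k B] [Algebra A B] [IsScalarTower k A B] {n : ℕ} {z : Fin n → A}
  (b : Module.Basis (Fin n) A Ω[A⁄k])

variable (k B z) in
/-- The pull-back of the form `dz₁ ∧ ⋯ ∧ dzₙ` from `A` to `B`. -/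
noncomputable def pullbackForm : ⋀[B]^n (Ω[B⁄k]) :=
  exteriorPower.ιMulti B n fun i => KaehlerDifferential.D k B (algebraMap A B (z i))

/-- The chain rule for the pull-back of `dg`. -/
theorem D_algebraMap_eq_sum (hb : ∀ i, b i = KaehlerDifferential.D k A (z i)) (g : A) :
    KaehlerDifferential.D k B (algebraMap A B g) =
      ∑ j, algebraMap A B (b.repr (KaehlerDifferential.D k A g) j) •
        KaehlerDifferential.D k B (algebraMap A B (z j)) := by
  rw [← KaehlerDifferential.map_D k k A B g]
  conv_lhs => rw [← b.sum_repr (KaehlerDifferential.D k A g), map_sum]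
  refine Finset.sum_congr rfl fun j _ => ?_
  rw [map_smul, hb, KaehlerDifferential.map_D, algebraMap_smul]

/-- The pulled back top forms are the multiples of the pull-back of a generating form. -/
theorem pullbackForms_eq_span (hb : ∀ i, b i = KaehlerDifferential.D k A (z i)) :
    pullbackForms k A B n = Submodule.span B {pullbackForm k B z} := by
  refine le_antisymm (Submodule.span_le.mpr ?_)
    (Submodule.span_mono (Set.singleton_subset_iff.mpr ⟨z, rfl⟩))
  rintro _ ⟨a, rfl⟩
  dsimp only
  simp_rw [D_algebraMap_eq_sum b hb (a _)]
  rw [alternatingMap_sum_smul (exteriorPower.ιMulti B n) _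
    (fun i j => algebraMap A B (b.repr (KaehlerDifferential.D k A (a i)) j))]
  exact Submodule.smul_mem _ _ (Submodule.mem_span_singleton_self _)

/-- Replacing `dzᵢ` by `dg` multiplies the form `dz₁ ∧ ⋯ ∧ dzₙ` by the partial derivative
`∂g/∂zᵢ`. -/
theorem repr_smul_pullbackForm (hb : ∀ i, b i = KaehlerDifferential.D k A (z i)) (g : A)
    (i : Fin n) :
    algebraMap A B (b.repr (KaehlerDifferential.D k A g) i) • pullbackForm k B z =
      exteriorPower.ιMulti B n (Function.update
        (fun j => KaehlerDifferential.D k B (algebraMap A B (z j))) i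
        (KaehlerDifferential.D k B (algebraMap A B g))) := by
  rw [D_algebraMap_eq_sum b hb g, AlternatingMap.map_update_sum, Finset.sum_eq_single i]
  · rw [AlternatingMap.map_update_smul, Function.update_eq_self]
    rfl
  · intro j _ hj
    rw [AlternatingMap.map_update_smul, AlternatingMap.map_update_self _ _ hj.symm, smul_zero]
  · exact fun h => absurd (Finset.mem_univ i) h

end Forms

/-- The pull-back of a generating form to a ring with the same fraction field does not vanish. -/
theorem pullbackForm_ne_zero {k A B : Type*} [CommRing k] [CommRing A] [CommRing B] [Algebra k A]
    [Algebra k B] [Algebra A B] {n : ℕ} {z : Fin n → A} (b : Module.Basis (Fin n) A Ω[A⁄k])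
    (hb : ∀ i, b i = KaehlerDifferential.D k A (z i))
    (L : Type*) [Field L] [Algebra A L] [Algebra B L] [Algebra k L] [IsScalarTower k A L]
    [IsScalarTower k B L] [IsScalarTower A B L] [IsDomain A] [IsFractionRing A L] :
    pullbackForm k B z ≠ 0 := by
  intro h
  let bL : Module.Basis (Fin n) L Ω[L⁄k] :=
    b.ofIsLocalizedModule L (nonZeroDivisors A) (KaehlerDifferential.map k k A L)
  have h1 := exteriorPower.alternatingMapLinearEquiv_apply_ιMulti
    (detForm fun j => ((bL.coord j).restrictScalars B).comp (KaehlerDifferential.map k k B L))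
    (fun i => KaehlerDifferential.D k B (algebraMap A B (z i)))
  have h2 : exteriorPower.ιMulti B n
    (fun i => KaehlerDifferential.D k B (algebraMap A B (z i))) = 0 := h
  rw [h2, map_zero, detForm_apply] at h1
  have h3 : (Matrix.of fun i j => (((bL.coord j).restrictScalars B).comp
      (KaehlerDifferential.map k k B L)) (KaehlerDifferential.D k B (algebraMap A B (z i)))) =
      (1 : Matrix (Fin n) (Fin n) L) := by
    ext i j
    have h4 : KaehlerDifferential.D k L (algebraMap A L (z i)) = bL i := by
      rw [Module.Basis.ofIsLocalizedModule_apply, hb, KaehlerDifferential.map_D]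
    simp [← IsScalarTower.algebraMap_apply, h4, Matrix.one_apply, Finsupp.single_apply]
  rw [h3, Matrix.det_one] at h1
  exact zero_ne_one h1

section DVR

variable {k B : Type*} [Field k] [CommRing B] [IsDomain B]
  [IsDiscreteValuationRing B] [Algebra k B]

theorem mem_maximalIdeal_pow_smul_top_iff {M : Type*} [AddCommGroup M] [Module B M] {t : B}
    (ht : Irreducible t) (j : ℕ) (x : M) :
    x ∈ maximalIdeal B ^ j • (⊤ : Submodule B M) ↔ ∃ y, x = t ^ j • y := by
  rw [ht.maximalIdeal_eq, Ideal.span_singleton_pow, Submodule.ideal_span_singleton_smul,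
    Submodule.mem_smul_pointwise_iff_exists]
  simp [eq_comm]

/-- A wedge product containing the differentials of `g` and of a nonunit is divisible by the same
power of the uniformizer `t` as `g`: the terms in `dt` of the two differentials cancel. -/
theorem ιMulti_mem_pow_smul {n : ℕ} (v : Fin n → Ω[B⁄k]) {i j : Fin n} (hij : i ≠ j) {g h : B}
    (hi : v i = KaehlerDifferential.D k B g) (hj : v j = KaehlerDifferential.D k B h)
    (hh : h ∈ maximalIdeal B) {r : ℕ} (hg : g ∈ maximalIdeal B ^ r) :
    exteriorPower.ιMulti B n v ∈ maximalIdeal B ^ r • (⊤ : Submodule B (⋀[B]^n (Ω[B⁄k]))) := by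
  obtain ⟨t, ht⟩ := IsDiscreteValuationRing.exists_irreducible B
  cases r with
  | zero => simp
  | succ r =>
  rw [ht.maximalIdeal_eq, Ideal.span_singleton_pow, Ideal.mem_span_singleton'] at hg
  rw [ht.maximalIdeal_eq, Ideal.mem_span_singleton'] at hh
  obtain ⟨g, rfl⟩ := hg
  obtain ⟨h, rfl⟩ := hh
  rw [mem_maximalIdeal_pow_smul_top_iff ht]
  set d := KaehlerDifferential.D k B
  set F := exteriorPower.ιMulti (M := Ω[B⁄k]) B n
  have e1 : v = Function.update (Function.update v i (t ^ r • (t • d g + (g * (r + 1 : ℕ)) • d t)))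
      j (t • d h + h • d t) := by
    rw [← show v i = t ^ r • (t • d g + (g * (r + 1 : ℕ)) • d t) by
      rw [hi, d.leibniz, d.leibniz_pow]
      simp only [Nat.add_sub_cancel, ← Nat.cast_smul_eq_nsmul B, smul_smul, smul_add]
      rw [add_comm]
      congr 2 <;> ring, ← show v j = t • d h + h • d t by
      rw [hj, d.leibniz, add_comm], Function.update_eq_self, Function.update_eq_self]
  have e2 : ∀ w w' : Ω[B⁄k], F (Function.update (Function.update v i w) j w') =
      F (Function.update (Function.update v j w') i w) := fun w w' => by
    rw [Function.update_comm hij]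
  rw [e1, e2, AlternatingMap.map_update_smul, AlternatingMap.map_update_add,
    AlternatingMap.map_update_smul, AlternatingMap.map_update_smul, ← e2 (d t),
    AlternatingMap.map_update_add, AlternatingMap.map_update_smul, AlternatingMap.map_update_smul]
  -- The term in `dt ∧ dt` is the only one not divisible by `t ^ (r + 1)`.
  have e3 : F (Function.update (Function.update v i (d t)) j (d t)) = 0 := by
    refine F.map_eq_zero_of_eq _ ?_ hij
    simp [Function.update_of_ne hij]
  rw [e3, smul_zero, add_zero]
  refine ⟨F (Function.update (Function.update v j (t • d h + h • d t)) i (d g)) +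
    (g * (r + 1 : ℕ)) • F (Function.update (Function.update v i (d t)) j (d h)), ?_⟩
  rw [smul_comm _ t, ← smul_add, smul_smul, pow_succ]

variable [Algebra.EssFiniteType k B]
  {A : Type*} [CommRing A] [Algebra k A] [Algebra A B] [IsScalarTower k A B]
  {z : Fin (Module.finrank A Ω[A⁄k]) → A}
  (b : Module.Basis (Fin (Module.finrank A Ω[A⁄k])) A Ω[A⁄k])

/-- If the pulled back generating form does not vanish, the supremum that defines the Jacobian order
is attained: the set is bounded by Krull's intersection theorem. -/
theorem le_jacobianOrder_iff (hb : ∀ i, b i = KaehlerDifferential.D k A (z i))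
    (h0 : pullbackForm k B z ≠ 0) {r : ℕ} :
    r ≤ jacobianOrder k A B ↔
      pullbackForm k B z ∈ maximalIdeal B ^ r • (⊤ : Submodule B (⋀[B]^_ (Ω[B⁄k]))) := by
  have hset : ∀ r, pullbackForms k A B (Module.finrank A (Ω[A⁄k])) ≤ maximalIdeal B ^ r •
      (⊤ : Submodule B (⋀[B]^(Module.finrank A (Ω[A⁄k])) (Ω[B⁄k]))) ↔
      pullbackForm k B z ∈ maximalIdeal B ^ r • (⊤ : Submodule B (⋀[B]^_ (Ω[B⁄k]))) := fun r => by
    rw [pullbackForms_eq_span b hb, Submodule.span_singleton_le_iff_mem]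
  have hanti : ∀ r s : ℕ, r ≤ s →
      pullbackForm k B z ∈ maximalIdeal B ^ s • (⊤ : Submodule B (⋀[B]^_ (Ω[B⁄k]))) →
      pullbackForm k B z ∈ maximalIdeal B ^ r • (⊤ : Submodule B (⋀[B]^_ (Ω[B⁄k]))) :=
    fun r s hrs h => Submodule.smul_mono_left (Ideal.pow_le_pow_right hrs) h
  obtain ⟨N, hN⟩ : ∃ N : ℕ, pullbackForm k B z ∉
      maximalIdeal B ^ N • (⊤ : Submodule B (⋀[B]^_ (Ω[B⁄k]))) := by
    by_contra! h
    have h1 : pullbackForm k B z ∈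
        (⨅ i : ℕ, maximalIdeal B ^ i • ⊤ : Submodule B (⋀[B]^_ (Ω[B⁄k]))) :=
      (Submodule.mem_iInf _).mpr h
    rw [Ideal.iInf_pow_smul_eq_bot_of_isLocalRing _ (maximalIdeal.isMaximal B).ne_top] at h1
    exact h0 h1
  have hbdd : BddAbove {r : ℕ | pullbackForms k A B (Module.finrank A (Ω[A⁄k])) ≤
      maximalIdeal B ^ r •
        (⊤ : Submodule B (⋀[B]^(Module.finrank A (Ω[A⁄k])) (Ω[B⁄k])))} := by
    refine ⟨N, fun r hr => ?_⟩
    by_contra! h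
    exact hN (hanti _ _ h.le ((hset r).mp hr))
  refine ⟨fun h => ?_, fun h => le_csSup hbdd ((hset r).mpr h)⟩
  refine hanti _ _ h ((hset _).mp (Nat.sSup_mem ⟨0, ?_⟩ hbdd))
  simp

variable [CharZero k]

/-- If a multiple of the generating form vanishes to order `j` along `B`, then the factor has
valuation at least `j` minus the Jacobian order; this uses that `Ω` is free, as `B` is smooth. -/
theorem le_addVal_add_jacobianOrder (hb : ∀ i, b i = KaehlerDifferential.D k A (z i))
    (h0 : pullbackForm k B z ≠ 0) {c : B} {j : ℕ}
    (hc : c • pullbackForm k B z ∈ maximalIdeal B ^ j • (⊤ : Submodule B (⋀[B]^_ (Ω[B⁄k])))) :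
    (j : ℕ∞) ≤ IsDiscreteValuationRing.addVal B c + jacobianOrder k A B := by
  have : Algebra.FormallySmooth k B := formallySmooth_of_isDiscreteValuationRing
  have : Module.Free B Ω[B⁄k] := Module.free_of_flat_of_isLocalRing
  by_cases hc0 : c = 0
  · simp [hc0]
  obtain ⟨t, ht⟩ := IsDiscreteValuationRing.exists_irreducible B
  obtain ⟨l, u, rfl⟩ := IsDiscreteValuationRing.eq_unit_mul_pow_irreducible hc0 ht
  rw [IsDiscreteValuationRing.addVal_def' u ht]
  rcases le_total j l with hjl | hjl
  · exact le_add_right (by exact_mod_cast hjl)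
  obtain ⟨m, rfl⟩ := Nat.exists_eq_add_of_le hjl
  rw [Nat.cast_add]
  gcongr
  rw [le_jacobianOrder_iff b hb h0, mem_maximalIdeal_pow_smul_top_iff ht]
  obtain ⟨y, hy⟩ := (mem_maximalIdeal_pow_smul_top_iff ht _ _).mp hc
  refine ⟨(↑u⁻¹ : B) • y, ?_⟩
  have hy' : t ^ l • pullbackForm k B z = t ^ l • t ^ m • (↑u⁻¹ : B) • y := by
    rw [smul_smul (t ^ l), ← pow_add, smul_comm, ← hy, smul_smul, ← mul_assoc, u.inv_mul, one_mul]
  exact smul_right_injective _ (pow_ne_zero l ht.ne_zero) hy'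

variable [IsDomain A] [IsLocalRing A] [IsNoetherianRing A] [Algebra.EssFiniteType k A]
  [Algebra.FormallySmooth k A] [IsLocalHom (algebraMap A B)]

/-- **Key estimate.** A derivation lowers a divisorial valuation with center of codimension at
least two by at most the discrepancy. -/
theorem addVal_le_addVal_derivation_add_jacobianOrder (hA : 2 ≤ ringKrullDim A)
    (L : Type*) [Field L] [Algebra A L] [Algebra B L] [Algebra k L] [IsScalarTower k A L]
    [IsScalarTower k B L] [IsScalarTower A B L] [IsFractionRing A L]
    (D : Derivation k A A) (g : A) :
    IsDiscreteValuationRing.addVal B (algebraMap A B g) ≤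
      IsDiscreteValuationRing.addVal B (algebraMap A B (D g)) + jacobianOrder k A B := by
  obtain ⟨z, b, hb, i₀, i₁, hne, h₀, h₁⟩ := exists_basis_D_of_two_le_ringKrullDim (k := k) hA
  have hz : ∀ a ∈ maximalIdeal A, algebraMap A B a ∈ maximalIdeal B := fun a ha =>
    ((local_hom_TFAE (algebraMap A B)).out 0 2 rfl rfl).mp inferInstance
      (Ideal.mem_map_of_mem _ ha)
  have hω := pullbackForm_ne_zero (B := B) b hb L
  refine ENat.forall_natCast_le_iff_le.mp fun j hj => ?_
  obtain ⟨t, ht⟩ := IsDiscreteValuationRing.exists_irreducible B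
  have hgj : algebraMap A B g ∈ maximalIdeal B ^ j := by
    rw [ht.maximalIdeal_eq, Ideal.span_singleton_pow, Ideal.mem_span_singleton,
      ← IsDiscreteValuationRing.addVal_le_iff_dvd, ht.addVal_pow]
    exact hj
  refine le_addVal_add_jacobianOrder b hb hω ?_
  have hD : D g = ∑ i, b.repr (KaehlerDifferential.D k A g) i * D (z i) := by
    rw [← D.liftKaehlerDifferential_comp_D g]
    conv_lhs => rw [← b.sum_repr (KaehlerDifferential.D k A g), map_sum]
    simp [hb]
  rw [hD, map_sum, Finset.sum_smul]
  refine Submodule.sum_mem _ fun i _ => ?_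
  rw [map_mul, mul_comm, mul_smul, repr_smul_pullbackForm b hb]
  refine Submodule.smul_mem _ _ ?_
  -- Of the two coordinates in the maximal ideal, at least one is not replaced by `g`.
  obtain ⟨j', hj', hzj⟩ : ∃ j', i ≠ j' ∧ z j' ∈ maximalIdeal A := by
    by_cases h : i = i₀
    · exact ⟨i₁, h ▸ hne, h₁⟩
    · exact ⟨i₀, h, h₀⟩
  exact ιMulti_mem_pow_smul (h := algebraMap A B (z j')) _ hj' (Function.update_self ..)
    (Function.update_of_ne hj'.symm ..) (hz _ hzj) hgj

end DVR

end Izumi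

namespace Izumi

open IsLocalRing

/-! ### The upper bound by the discrepancy -/

/-- Derivations extend to localizations. -/
theorem exists_derivation_localization {k R : Type*} (A : Type*) [CommRing k] [CommRing R]
    [CommRing A] [Algebra k R] [Algebra k A] [Algebra R A] [IsScalarTower k R A] (M : Submonoid R)
    [IsLocalization M A] (D : Derivation k R R) :
    ∃ D' : Derivation k A A, ∀ r, D' (algebraMap R A r) = algebraMap R A (D r) := by
  let φ : Ω[R⁄k] →ₗ[R] A := (Algebra.linearMap R A).comp D.liftKaehlerDifferential
  have hu := IsLocalizedModule.map_units (S := M) (Algebra.linearMap R A)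
  let ψ : Ω[A⁄k] →ₗ[R] A := IsLocalizedModule.lift M (KaehlerDifferential.map k k R A) φ hu
  let χ : Ω[A⁄k] →ₗ[A] A := LinearMap.extendScalarsOfIsLocalization M A ψ
  refine ⟨χ.compDer (KaehlerDifferential.D k A), fun r => ?_⟩
  have h := IsLocalizedModule.lift_apply M (KaehlerDifferential.map k k R A) φ
    hu (KaehlerDifferential.D k R r)
  rw [KaehlerDifferential.map_D] at h
  refine h.trans ?_
  simp [φ]

variable {k R A B : Type*} [Field k] [CharZero k]
  [CommRing A] [IsDomain A] [IsLocalRing A] [IsNoetherianRing A] [Algebra k A]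
  [Algebra.EssFiniteType k A] [Algebra.FormallySmooth k A]
  [CommRing B] [IsDomain B] [IsDiscreteValuationRing B] [Algebra k B] [Algebra.EssFiniteType k B]
  [Algebra A B] [IsScalarTower k A B] [IsLocalHom (algebraMap A B)]
  (L : Type*) [Field L] [Algebra A L] [Algebra B L] [Algebra k L] [IsScalarTower k A L]
  [IsScalarTower k B L] [IsScalarTower A B L] [IsFractionRing A L]

include L in
/-- The discrepancy is positive: the derivation dual to a coordinate vanishing on the center turns
this coordinate into `1`. -/
theorem one_le_jacobianOrder (hA : 2 ≤ ringKrullDim A) : 1 ≤ jacobianOrder k A B := by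
  obtain ⟨z, b, hb, i, -, -, hi, -⟩ := exists_basis_D_of_two_le_ringKrullDim (k := k) hA
  have h := addVal_le_addVal_derivation_add_jacobianOrder (B := B) hA L
    ((b.coord i).compDer (KaehlerDifferential.D k A)) (z i)
  have h1 : (b.coord i).compDer (KaehlerDifferential.D k A) (z i) = 1 := by
    simp [← hb]
  rw [h1, map_one, IsDiscreteValuationRing.addVal_one, zero_add] at h
  have h2 : IsDiscreteValuationRing.addVal B (algebraMap A B (z i)) ≠ 0 := by
    rw [Ne, IsDiscreteValuationRing.addVal_eq_zero_iff]
    exact fun hu => (mem_maximalIdeal _).mp hi (isUnit_of_map_unit (algebraMap A B) _ hu)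
  exact_mod_cast (Order.one_le_iff_ne_zero.mpr h2).trans h

include L in
/-- The valuation of a function of order `n` is at most `n` times the discrepancy: some derivation
turns the function into a unit after `n` steps, and each step costs at most the discrepancy. -/
theorem addVal_le_jacobianOrder_mul_mult [CommRing R] [IsLocalRing R] [IsNoetherianRing R]
    [Algebra k R] [Algebra R A] [Algebra R B] [IsScalarTower k R A] [IsScalarTower R A B]
    (M : Submonoid R) [IsLocalization M A] {ι : Type*} [Fintype ι] [DecidableEq ι]
    (𝒞 : LocalCoordinates k R ι) (hA : 2 ≤ ringKrullDim A) (g : R) :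
    IsDiscreteValuationRing.addVal B (algebraMap R B g) ≤
      (jacobianOrder k A B : ℕ∞) * mult R g := by
  by_cases hg : mult R g = ⊤
  -- For `g = 0` the right-hand side is `⊤` only because the Jacobian order is positive.
  · have := one_le_jacobianOrder (B := B) L hA (k := k)
    rw [hg, ENat.mul_top (by exact_mod_cast (Nat.one_le_iff_ne_zero.mp this))]
    exact le_top
  obtain ⟨n, hn⟩ := ENat.ne_top_iff_exists.mp hg
  obtain ⟨h1, h2⟩ := mult_eq_iff.mp hn.symm
  obtain ⟨a, ha⟩ := 𝒞.exists_isUnit_dir_iterate h1 h2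
  obtain ⟨D', hD'⟩ := exists_derivation_localization A M (𝒞.dir a)
  have hiter : ∀ m, IsDiscreteValuationRing.addVal B (algebraMap R B g) ≤
      IsDiscreteValuationRing.addVal B (algebraMap R B ((𝒞.dir a)^[m] g)) +
        jacobianOrder k A B * m := fun m => by
    induction m with
    | zero => simp
    | succ m ih =>
      refine ih.trans ?_
      have := addVal_le_addVal_derivation_add_jacobianOrder (B := B) hA L D'
        (algebraMap R A ((𝒞.dir a)^[m] g))
      rw [hD', ← IsScalarTower.algebraMap_apply, ← IsScalarTower.algebraMap_apply] at this
      rw [Function.iterate_succ_apply', Nat.cast_add_one, mul_add, mul_one,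
        add_comm (_ * _ : ℕ∞) (jacobianOrder k A B : ℕ∞), ← add_assoc]
      gcongr
  have h := hiter n
  rwa [(IsDiscreteValuationRing.addVal_eq_zero_iff).mpr (ha.map (algebraMap R B)), zero_add, hn]
    at h

end Izumi

namespace Izumi

open IsLocalRing

/-! ### The discrepancy of the multiplicity on a surface -/

namespace LocalCoordinates

variable {k R ι : Type*} [Field k] [CommRing R] [IsLocalRing R] [Algebra k R]
  [DecidableEq ι] (𝒞 : LocalCoordinates k R ι)

theorem mult_y (i : ι) : mult R (𝒞.y i) = (1 : ℕ) := by
  rw [mult_eq_iff, pow_one]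
  refine ⟨𝒞.y_mem i, fun h => ?_⟩
  have := derivation_mem_pow _ (𝒞.partialD i) 1 h
  rw [𝒞.partialD_y, if_pos rfl, pow_one] at this
  exact (mem_maximalIdeal _).mp this isUnit_one

variable [Fintype ι]

/-- The Euler vector field `∑ yᵢ ∂ᵢ`. -/
def euler : Derivation k R R := ∑ i, 𝒞.y i • 𝒞.partialD i

theorem euler_apply (g : R) : 𝒞.euler g = ∑ i, 𝒞.y i * 𝒞.partialD i g := by
  rw [euler, ← Derivation.coeFnAddMonoidHom_apply, map_sum, Finset.sum_apply]
  rfl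

theorem euler_mem (g : R) : 𝒞.euler g ∈ maximalIdeal R := by
  rw [euler_apply]
  exact Submodule.sum_mem _ fun i _ => Ideal.mul_mem_right _ _ (𝒞.y_mem i)

/-- Euler's formula for the leading term. -/
theorem euler_sub_mem (n : ℕ) {g : R} (hg : g ∈ maximalIdeal R ^ n) :
    𝒞.euler g - n * g ∈ maximalIdeal R ^ (n + 1) := by
  induction n generalizing g with
  | zero => simpa using 𝒞.euler_mem g
  | succ n ih =>
    rw [pow_succ', ← 𝒞.span_y] at hg
    refine Submodule.mul_induction_on hg (fun a ha b hb => ?_) fun a b ha hb => ?_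
    · have h1 : 𝒞.euler a - a ∈ maximalIdeal R ^ 2 := by
        refine Submodule.span_induction ?_ ?_ ?_ ?_ ha
        · rintro _ ⟨i, rfl⟩
          simp [euler_apply, 𝒞.partialD_y]
        · simp
        · intro x y _ _ hx hy
          rw [map_add, add_sub_add_comm]
          exact add_mem hx hy
        · intro c x hx hx'
          replace hx : x ∈ maximalIdeal R := 𝒞.span_y ▸ hx
          rw [smul_eq_mul, Derivation.leibniz, smul_eq_mul, smul_eq_mul, add_sub_right_comm,
            ← mul_sub]
          refine add_mem (Ideal.mul_mem_left _ _ hx') ?_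
          rw [pow_two]
          exact Ideal.mul_mem_mul hx (𝒞.euler_mem c)
      rw [𝒞.span_y] at ha hb
      have h2 : 𝒞.euler (a * b) - (n + 1 : ℕ) * (a * b) =
          a * (𝒞.euler b - n * b) + b * (𝒞.euler a - a) := by
        rw [Derivation.leibniz]
        push_cast
        simp only [smul_eq_mul]
        ring
      rw [h2]
      refine add_mem ?_ ?_
      · rw [pow_succ']
        exact Ideal.mul_mem_mul ha (ih hb)
      · rw [show n + 1 + 1 = n + 2 by rfl, pow_add]
        exact Ideal.mul_mem_mul hb h1
    · rw [map_add, mul_add, add_sub_add_comm]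
      exact add_mem ha hb

end LocalCoordinates

/-- A derivation of `B` with values in the fraction field which takes values in `B`. -/
theorem exists_derivation_of_range {k B : Type*} (L : Type*) [CommRing k] [CommRing B] [Algebra k B]
    [Field L] [Algebra B L] [Algebra k L] [IsScalarTower k B L] [IsFractionRing B L]
    (D : Derivation k B L)
    (hD : ∀ b, ∃ c, algebraMap B L c = D b) :
    ∃ D' : Derivation k B B, ∀ b, algebraMap B L (D' b) = D b := by
  choose f hf using hD
  have hinj := IsFractionRing.injective B L
  refine ⟨Derivation.mk'
    { toFun := f, map_add' := fun a b => hinj ?_, map_smul' := fun c b => hinj ?_ }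
    fun a b => hinj ?_, hf⟩
  · simp [hf]
  · simp [hf, Algebra.smul_def, ← IsScalarTower.algebraMap_apply]
  · simp [hf, Algebra.smul_def]

section Mult

variable {R B L : Type*} [CommRing R] [IsLocalRing R] [CommRing B] [IsDomain B]
  [IsDiscreteValuationRing B] [Algebra R B] [Field L] [Algebra R L] [Algebra B L]
  [IsScalarTower R B L]
  (hv : ∀ g : R, IsDiscreteValuationRing.addVal B (algebraMap R B g) = mult R g)
include hv

/-- If `B` is the valuation ring of the order on `R`, a fraction lies in `B` as soon as the order of
its numerator is at least that of its denominator. -/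
theorem exists_algebraMap_eq_div {w d : R} (h : mult R d ≤ mult R w) :
    ∃ c, algebraMap B L c = algebraMap R L w / algebraMap R L d := by
  rw [← hv, ← hv, IsDiscreteValuationRing.addVal_le_iff_dvd] at h
  obtain ⟨c, hc⟩ := h
  by_cases hd : algebraMap R L d = 0
  · exact ⟨0, by simp [hd]⟩
  refine ⟨c, ?_⟩
  rw [eq_div_iff hd, IsScalarTower.algebraMap_apply R B L, IsScalarTower.algebraMap_apply R B L,
    hc, map_mul, mul_comm]

variable {k : Type*} [Field k] [Algebra k R] [Algebra k L] [IsNoetherianRing R]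
  [IsFractionRing R L] [IsFractionRing B L]

/-- A derivation of the fraction field, induced by a multiple `d⁻¹ D` of a derivation `D` of `R`,
preserves `B` as soon as the numerator of the derivative of a fraction has large order. -/
theorem exists_algebraMap_eq_derivation (D : Derivation k R R) (D' : Derivation k L L)
    (hD' : ∀ r, D' (algebraMap R L r) = algebraMap R L (D r)) (c d : R)
    (h : ∀ (n : ℕ) (g q : R), mult R q = n → (n : ℕ∞) ≤ mult R g →
      mult R (q ^ 2 * d) ≤ mult R (c * (q * D g - g * D q))) (b : B) :
    ∃ e, algebraMap B L e =
      algebraMap R L c / algebraMap R L d * D' (algebraMap B L b) := by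
  have : IsDomain R := (IsFractionRing.injective R L).isDomain _
  obtain ⟨g, q, hq, hgq⟩ := IsFractionRing.div_surjective (A := R) (algebraMap B L b)
  have hq0 : q ≠ 0 := nonZeroDivisors.ne_zero hq
  have hqL : algebraMap R L q ≠ 0 := by
    rwa [Ne, (injective_iff_map_eq_zero' _).mp (IsFractionRing.injective R L)]
  obtain ⟨n, hn⟩ := ENat.ne_top_iff_exists.mp (mt mult_eq_top_iff.mp hq0)
  have hbq : algebraMap R B g = b * algebraMap R B q := by
    apply IsFractionRing.injective B L
    rw [map_mul, ← hgq, ← IsScalarTower.algebraMap_apply, ← IsScalarTower.algebraMap_apply,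
      div_mul_cancel₀ _ hqL]
  have hng : (n : ℕ∞) ≤ mult R g := by
    rw [hn, ← hv, ← hv, hbq, IsDiscreteValuationRing.addVal_mul]
    exact le_add_self
  obtain ⟨e, he⟩ := exists_algebraMap_eq_div (L := L) hv (h n g q hn.symm hng)
  refine ⟨e, ?_⟩
  have hdiv : D' (algebraMap B L b) = (algebraMap R L q * algebraMap R L (D g) -
      algebraMap R L g * algebraMap R L (D q)) / algebraMap R L q ^ 2 := by
    have h1 : D' (algebraMap B L b * algebraMap R L q) = algebraMap R L (D g) := by
      rw [← hgq, div_mul_cancel₀ _ hqL, hD']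
    rw [D'.leibniz, hD', smul_eq_mul, smul_eq_mul, ← hgq] at h1
    rw [eq_div_iff (pow_ne_zero 2 hqL), ← h1, ← hgq]
    field_simp
    ring
  rw [he, hdiv]
  by_cases hd : algebraMap R L d = 0
  · simp [hd]
  simp only [map_mul, map_sub, map_pow]
  field_simp

end Mult

variable {k R B : Type*} [Field k] [CommRing R] [IsLocalRing R]
  [IsNoetherianRing R] [Algebra k R] [CommRing B] [IsDomain B] [IsDiscreteValuationRing B]
  [Algebra k B] [Algebra R B]
  (L : Type*) [Field L] [Algebra R L] [Algebra B L] [Algebra k L] [IsScalarTower k R L]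
  [IsScalarTower k B L] [IsScalarTower R B L] [IsFractionRing B L]

/-- If the valuation of `B` restricts to the order on `R`, and `R` has two local coordinates
`y₀, y₁`, then the derivations `y₀⁻¹ (y₀ ∂₀ + y₁ ∂₁)` and `y₀ ∂₁` preserve `B`. They
have determinant `y₀` on the coordinates, so `dy₀ ∧ dy₁` vanishes at most to first order. -/
theorem pullbackForm_notMem_sq_smul [CharZero k] [IsFractionRing R L]
    (hv : ∀ g : R, IsDiscreteValuationRing.addVal B (algebraMap R B g) = mult R g)
    {n : ℕ} (hn : n = 2) (𝒞 : LocalCoordinates k R (Fin n)) :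
    pullbackForm k B 𝒞.y ∉ maximalIdeal B ^ 2 • (⊤ : Submodule B (⋀[B]^n (Ω[B⁄k]))) := by
  subst hn
  intro hmem
  have hmulm := 𝒞.mult_mul
  have hinj := IsFractionRing.injective B L
  have hy1 : mult R (𝒞.y 0) = (1 : ℕ) := 𝒞.mult_y 0
  have hy0 : algebraMap R L (𝒞.y 0) ≠ 0 := by
    rw [Ne, (injective_iff_map_eq_zero' _).mp (IsFractionRing.injective R L)]
    exact fun h => by simp [h, mult_zero] at hy1
  obtain ⟨D₀, hD₀⟩ := exists_derivation_localization L (nonZeroDivisors R) 𝒞.euler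
  obtain ⟨D₁, hD₁⟩ := exists_derivation_localization L (nonZeroDivisors R) (𝒞.partialD 1)
  have h₀ := exists_algebraMap_eq_derivation hv 𝒞.euler D₀ hD₀ 1 (𝒞.y 0) (by
    intro n g q hq hg
    rw [hmulm, hy1, pow_two, hmulm, hq, one_mul]
    obtain ⟨hq1, -⟩ := mult_eq_iff.mp hq
    have hg1 := le_mult_iff.mp hg
    rw [show (n : ℕ∞) + n + (1 : ℕ) = (n + (n + 1) : ℕ) by push_cast; ring, le_mult_iff]
    have : q * 𝒞.euler g - g * 𝒞.euler q =
        q * (𝒞.euler g - n * g) - g * (𝒞.euler q - n * q) := by ring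
    rw [this, pow_add]
    exact sub_mem (Ideal.mul_mem_mul hq1 (𝒞.euler_sub_mem n hg1))
      (Ideal.mul_mem_mul hg1 (𝒞.euler_sub_mem n hq1)))
  have h₁ := exists_algebraMap_eq_derivation hv (𝒞.partialD 1) D₁ hD₁ (𝒞.y 0) 1 (by
    intro n g q hq hg
    rw [mul_one, hmulm, hy1, pow_two, hmulm, hq]
    obtain ⟨hq1, -⟩ := mult_eq_iff.mp hq
    have hg1 := le_mult_iff.mp hg
    cases n with
    | zero => simp
    | succ n =>
      rw [show ((n + 1 : ℕ) : ℕ∞) + (n + 1 : ℕ) = (1 : ℕ) + ((n + 1) + n : ℕ) by push_cast; ring]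
      gcongr
      rw [le_mult_iff, pow_add]
      exact sub_mem (Ideal.mul_mem_mul hq1 (derivation_mem_pow _ _ n hg1))
        (Ideal.mul_mem_mul hg1 (derivation_mem_pow _ _ n hq1)))
  obtain ⟨E₀, hE₀⟩ := exists_derivation_of_range L
    (((algebraMap R L 1 / algebraMap R L (𝒞.y 0)) • D₀).compAlgebraMap B) h₀
  obtain ⟨E₁, hE₁⟩ := exists_derivation_of_range L
    (((algebraMap R L (𝒞.y 0) / algebraMap R L 1) • D₁).compAlgebraMap B) h₁
  obtain ⟨t, ht⟩ := IsDiscreteValuationRing.exists_irreducible B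
  obtain ⟨w, hw⟩ := (mem_maximalIdeal_pow_smul_top_iff ht 2 _).mp hmem
  -- Evaluating the determinant of `E₀` and `E₁` on the form gives `y₀`, which has value one,
  -- whereas the form is divisible by `t ^ 2`.
  have hdet := exteriorPower.alternatingMapLinearEquiv_apply_ιMulti
    (detForm ![E₀.liftKaehlerDifferential, E₁.liftKaehlerDifferential])
    (fun i => KaehlerDifferential.D k B (algebraMap R B (𝒞.y i)))
  rw [pullbackForm] at hw
  rw [hw, map_smul, detForm_apply, Matrix.det_fin_two] at hdet
  simp only [Matrix.of_apply, Matrix.cons_val_zero, Matrix.cons_val_one,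
    Derivation.liftKaehlerDifferential_comp_D] at hdet
  have e₀ : ∀ i, algebraMap B L (E₀ (algebraMap R B (𝒞.y i))) =
      algebraMap R L (𝒞.y i) / algebraMap R L (𝒞.y 0) := fun i => by
    rw [hE₀, Derivation.compAlgebraMap_apply, ← IsScalarTower.algebraMap_apply,
      Derivation.smul_apply, hD₀, 𝒞.euler_apply]
    simp [𝒞.partialD_y, div_eq_inv_mul]
  have e₁ : ∀ i, algebraMap B L (E₁ (algebraMap R B (𝒞.y i))) =
      if i = 1 then algebraMap R L (𝒞.y 0) else 0 := fun i => by
    rw [hE₁, Derivation.compAlgebraMap_apply, ← IsScalarTower.algebraMap_apply,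
      Derivation.smul_apply, hD₁, 𝒞.partialD_y]
    simp only [eq_comm (a := i)]
    split_ifs <;> simp
  have hdet' : t ^ 2 * _ = algebraMap R B (𝒞.y 0) := hinj (by
    rw [← smul_eq_mul, hdet, map_sub, map_mul, map_mul, e₀, e₀, e₁, e₁]
    simp [div_self hy0, ← IsScalarTower.algebraMap_apply])
  have h2 := hv (𝒞.y 0)
  rw [← hdet', IsDiscreteValuationRing.addVal_mul, ht.addVal_pow, hy1] at h2
  have h3 : ((2 : ℕ) : ℕ∞) ≤ (1 : ℕ) := h2 ▸ le_self_add
  exact absurd h3 (by norm_num)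

/-- The discrepancy of the order valuation of a surface at a smooth point is at most one. -/
theorem jacobianOrder_le_one [CharZero k] [IsDomain R] [IsScalarTower k R B]
    [Algebra.EssFiniteType k B] [IsFractionRing R L]
    (hv : ∀ g : R, IsDiscreteValuationRing.addVal B (algebraMap R B g) = mult R g)
    (hn : Module.finrank R Ω[R⁄k] = 2)
    (𝒞 : LocalCoordinates k R (Fin (Module.finrank R Ω[R⁄k])))
    (b : Module.Basis (Fin (Module.finrank R Ω[R⁄k])) R Ω[R⁄k])
    (hb : ∀ i, b i = KaehlerDifferential.D k R (𝒞.y i)) :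
    jacobianOrder k R B ≤ 1 := by
  by_contra! h
  exact pullbackForm_notMem_sq_smul L hv hn 𝒞
    ((le_jacobianOrder_iff b hb (pullbackForm_ne_zero b hb L)).mp h)

end Izumi

namespace Izumi

open IsLocalRing

/-! ### The order valuation and the blow-up of a point -/

/-- Finiteness of the normalization in characteristic zero: by Noether normalization, `A` is finite
over a polynomial ring, and the function field is a finite separable extension of its fraction
field. -/
theorem finite_integralClosure (k A K : Type*) [Field k] [CharZero k] [CommRing A] [IsDomain A]
    [Algebra k A] [Algebra.FiniteType k A] [Field K] [Algebra A K] [IsFractionRing A K] :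
    Module.Finite A (integralClosure A K) := by
  obtain ⟨n, g, hg, hfin⟩ := exists_finite_inj_algHom_of_fg k A
  let P := MvPolynomial (Fin n) k
  let _ : Algebra P A := g.toRingHom.toAlgebra
  have : Module.Finite P A := hfin
  have : FaithfulSMul P A := (faithfulSMul_iff_algebraMap_injective P A).mpr hg
  let _ : Algebra P K := ((algebraMap A K).comp (algebraMap P A)).toAlgebra
  have : IsScalarTower P A K := .of_algebraMap_eq fun _ => rfl
  have : FaithfulSMul P K := (faithfulSMul_iff_algebraMap_injective P K).mpr
    ((IsFractionRing.injective A K).comp hg)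
  let F := FractionRing P
  let _ : Algebra F K := FractionRing.liftAlgebra P K
  have : CharZero F := by
    have : CharZero P := charZero_of_injective_algebraMap (MvPolynomial.C_injective (Fin n) k)
    exact charZero_of_injective_algebraMap (IsFractionRing.injective P F)
  have : IsScalarTower P F K := FractionRing.isScalarTower_liftAlgebra P K
  have : FiniteDimensional F K := by
    have : IsLocalization (Algebra.algebraMapSubmonoid A (nonZeroDivisors P)) K := inferInstance
    exact .of_isLocalization P A (nonZeroDivisors P)
  have : IsIntegralClosure (integralClosure A K) P K :=
    ⟨Subtype.val_injective, fun {z} => by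
      rw [← IsIntegralClosure.isIntegral_iff (A := integralClosure A K) (R := A)]
      exact ⟨IsIntegral.tower_top, isIntegral_trans z⟩⟩
  have : Module.Finite P (integralClosure A K) := IsIntegralClosure.finite P F K _
  exact Module.Finite.of_restrictScalars_finite P A _

theorem mult_eq_zero_iff {R : Type*} [CommRing R] [IsLocalRing R] {g : R} :
    mult R g = 0 ↔ IsUnit g := by
  rw [← Nat.cast_zero, mult_eq_iff, zero_add, pow_one, mem_maximalIdeal, mem_nonunits_iff, not_not]
  simp

theorem mult_pow_of_mult_eq_one {R : Type*} [CommRing R] [IsLocalRing R]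
    (hmul : ∀ g h : R, mult R (g * h) = mult R g + mult R h) {a : R} (ha : mult R a = 1) (n : ℕ) :
    mult R (a ^ n) = n := by
  induction n with
  | zero => simp [mult_eq_zero_iff.mpr isUnit_one]
  | succ n ih => rw [pow_succ, hmul, ih, ha]; rfl

section OrderValuation

variable {R : Type*} [CommRing R] [IsLocalRing R] [IsDomain R]
  (hmul : ∀ g h : R, mult R (g * h) = mult R g + mult R h)
  (K : Type*) [Field K] [Algebra R K] [IsFractionRing R K]

/-- If the order on `R` is multiplicative, the valuation ring of its extension to the fraction
field. -/
def orderValuationSubring : ValuationSubring K where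
  carrier := {z | ∃ g h : R, h ≠ 0 ∧ mult R h ≤ mult R g ∧ z = algebraMap R K g / algebraMap R K h}
  zero_mem' := ⟨0, 1, one_ne_zero, by simp [mult_zero], by simp⟩
  one_mem' := ⟨1, 1, one_ne_zero, le_rfl, by simp⟩
  neg_mem' := by
    rintro _ ⟨g, h, hh, hgh, rfl⟩
    refine ⟨-1 * g, h, hh, ?_, by simp [neg_div]⟩
    rw [hmul]
    exact hgh.trans le_add_self
  add_mem' := by
    rintro _ _ ⟨g, h, hh, hgh, rfl⟩ ⟨g', h', hh', hgh', rfl⟩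
    refine ⟨g * h' + h * g', h * h', mul_ne_zero hh hh', le_trans (le_min ?_ ?_) (mult_add _ _), ?_⟩
    · rw [hmul, hmul]; gcongr
    · rw [hmul, hmul]; gcongr
    · rw [div_add_div _ _ (by simpa) (by simpa)]
      simp
  mul_mem' := by
    rintro _ _ ⟨g, h, hh, hgh, rfl⟩ ⟨g', h', hh', hgh', rfl⟩
    refine ⟨g * g', h * h', mul_ne_zero hh hh', ?_, by simp [div_mul_div_comm]⟩
    rw [hmul, hmul]; gcongr
  mem_or_inv_mem' := by
    intro z
    obtain ⟨g, h, hh, rfl⟩ := IsFractionRing.div_surjective (A := R) z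
    by_cases hg : g = 0
    · exact Or.inl ⟨0, 1, one_ne_zero, by simp [mult_zero], by simp [hg]⟩
    rcases le_total (mult R h) (mult R g) with h1 | h1
    · exact Or.inl ⟨g, h, nonZeroDivisors.ne_zero hh, h1, rfl⟩
    · exact Or.inr ⟨h, g, hg, h1, by simp⟩

variable {K}

theorem algebraMap_mem_orderValuationSubring (g : R) :
    algebraMap R K g ∈ orderValuationSubring hmul K :=
  ⟨g, 1, one_ne_zero, by simp [mult_eq_zero_iff.mpr isUnit_one], by simp⟩

variable [IsNoetherianRing R]

theorem div_mem_orderValuationSubring_iff {g h : R} (hh : h ≠ 0) :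
    algebraMap R K g / algebraMap R K h ∈ orderValuationSubring hmul K ↔ mult R h ≤ mult R g := by
  refine ⟨?_, fun H => ⟨g, h, hh, H, rfl⟩⟩
  rintro ⟨g', h', hh', hgh, he⟩
  rw [div_eq_div_iff (by simpa) (by simpa), ← map_mul, ← map_mul,
    (IsFractionRing.injective R K).eq_iff] at he
  have h1 := congrArg (mult R) he
  rw [hmul, hmul] at h1
  have h2 : mult R h' ≠ ⊤ := mt mult_eq_top_iff.mp hh'
  rw [← ENat.add_le_add_iff_right h2, h1, add_comm]
  gcongr

theorem isUnit_orderValuationSubring {z : orderValuationSubring hmul K} {g h : R} (hg : g ≠ 0)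
    (hh : h ≠ 0) (hgh : mult R g = mult R h) (hz : (z : K) = algebraMap R K g / algebraMap R K h) :
    IsUnit z := by
  refine .of_mul_eq_one ⟨_, (div_mem_orderValuationSubring_iff hmul hg).mpr hgh.le⟩ ?_
  ext
  simp [hz, hg, hh]

variable (a : R)

/-- The image of an element of `R` in the valuation ring of the order. -/
def toOrderValuationSubring (g : R) : orderValuationSubring hmul K :=
  ⟨algebraMap R K g, algebraMap_mem_orderValuationSubring hmul g⟩

variable {a} (ha : mult R a = 1)
include ha

/-- An element of order one of `R` is a uniformizer of the valuation ring of the order. -/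
theorem exists_eq_unit_mul_pow (z : orderValuationSubring hmul K) (hz : z ≠ 0) :
    ∃ (n : ℕ) (u : (orderValuationSubring hmul K)ˣ),
      z = u * toOrderValuationSubring (K := K) hmul a ^ n := by
  obtain ⟨_, g, h, hh, hgh, rfl⟩ := z
  have hg : g ≠ 0 := fun h0 => hz (by ext; simp [h0])
  have ha0 : a ≠ 0 := by rintro rfl; simp [mult_zero] at ha
  obtain ⟨n, hn⟩ := ENat.ne_top_iff_exists.mp (mt mult_eq_top_iff.mp hh)
  obtain ⟨m, hm⟩ := ENat.ne_top_iff_exists.mp (mt mult_eq_top_iff.mp hg)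
  rw [← hn, ← hm, Nat.cast_le] at hgh
  obtain ⟨l, rfl⟩ := Nat.exists_eq_add_of_le hgh
  have hmm : mult R g = mult R (h * a ^ l) := by
    rw [hmul, mult_pow_of_mult_eq_one hmul ha, ← hn, ← hm]
    rfl
  refine ⟨l, (isUnit_orderValuationSubring hmul hg (mul_ne_zero hh (pow_ne_zero l ha0)) hmm
    (z := ⟨_, (div_mem_orderValuationSubring_iff hmul
      (mul_ne_zero hh (pow_ne_zero l ha0))).mpr hmm.ge⟩) rfl).unit, ?_⟩
  ext
  have : algebraMap R K a ≠ 0 := by simpa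
  simp only [IsUnit.unit_spec, MulMemClass.coe_mul, SubmonoidClass.coe_pow, toOrderValuationSubring,
    map_mul, map_pow]
  field_simp

theorem irreducible_toOrderValuationSubring :
    Irreducible (toOrderValuationSubring (K := K) hmul a) := by
  have ha0 : a ≠ 0 := by rintro rfl; simp [mult_zero] at ha
  have hα : ¬ IsUnit (toOrderValuationSubring (K := K) hmul a) := fun h => by
    obtain ⟨b, hb⟩ := h.exists_right_inv
    have h1 : (b : K) = algebraMap R K 1 / algebraMap R K a := by
      rw [map_one, eq_div_iff (by simpa), mul_comm]
      exact congrArg Subtype.val hb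
    have h2 := (div_mem_orderValuationSubring_iff hmul ha0).mp (h1 ▸ b.2)
    rw [ha, mult_eq_zero_iff.mpr isUnit_one] at h2
    simp at h2
  have h0 : toOrderValuationSubring (K := K) hmul a ≠ 0 := fun h =>
    ha0 (by simpa [toOrderValuationSubring] using congrArg Subtype.val h)
  refine ⟨hα, fun x y hxy => ?_⟩
  obtain ⟨n, u, hx⟩ := exists_eq_unit_mul_pow hmul ha x (left_ne_zero_of_mul (hxy ▸ h0))
  obtain ⟨m, v, hy⟩ := exists_eq_unit_mul_pow hmul ha y (right_ne_zero_of_mul (hxy ▸ h0))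
  cases n with
  | zero => left; simp [hx]
  | succ n =>
    cases m with
    | zero => right; simp [hy]
    | succ m =>
      refine absurd (IsUnit.of_mul_eq_one
        (u * v * toOrderValuationSubring (K := K) hmul a ^ (n + m))
        (mul_left_cancel₀ h0 ?_)) hα
      rw [mul_one]
      conv_rhs => rw [hxy, hx, hy]
      ring

theorem isDiscreteValuationRing_orderValuationSubring :
    IsDiscreteValuationRing (orderValuationSubring hmul K) :=
  .ofHasUnitMulPowIrreducibleFactorization
    ⟨_, irreducible_toOrderValuationSubring hmul ha, fun {x} hx => by
      obtain ⟨n, u, h⟩ := exists_eq_unit_mul_pow hmul ha x hx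
      exact ⟨n, u, by rw [h, mul_comm]⟩⟩

theorem addVal_toOrderValuationSubring [IsDiscreteValuationRing (orderValuationSubring hmul K)]
    (g : R) : IsDiscreteValuationRing.addVal (orderValuationSubring hmul K)
      (toOrderValuationSubring hmul g) = mult R g := by
  have hdvd : ∀ g h : R, g ≠ 0 → mult R g ≤ mult R h →
      toOrderValuationSubring (K := K) hmul g ∣ toOrderValuationSubring hmul h := by
    refine fun g h hg hgh => ⟨⟨_, (div_mem_orderValuationSubring_iff hmul hg).mpr hgh⟩, ?_⟩
    ext
    have : algebraMap R K g ≠ 0 := by simpa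
    simp only [toOrderValuationSubring, MulMemClass.mk_mul_mk]
    field_simp
  by_cases hg : g = 0
  · have : toOrderValuationSubring (K := K) hmul 0 = 0 := by ext; simp [toOrderValuationSubring]
    rw [hg, mult_zero, this, IsDiscreteValuationRing.addVal_zero]
  obtain ⟨n, hn⟩ := ENat.ne_top_iff_exists.mp (mt mult_eq_top_iff.mp hg)
  have ha0 : a ≠ 0 := by rintro rfl; simp [mult_zero] at ha
  have hpow := mult_pow_of_mult_eq_one hmul ha n
  have h1 : toOrderValuationSubring (K := K) hmul (a ^ n) = toOrderValuationSubring hmul a ^ n := by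
    ext; simp [toOrderValuationSubring]
  rw [← hn, ← (irreducible_toOrderValuationSubring (K := K) hmul ha).addVal_pow n, ← h1]
  apply le_antisymm
  · exact IsDiscreteValuationRing.addVal_le_iff_dvd.mpr (hdvd _ _ hg (by rw [hpow, hn]))
  · exact IsDiscreteValuationRing.addVal_le_iff_dvd.mpr
      (hdvd _ _ (pow_ne_zero n ha0) (by rw [hpow, hn]))

end OrderValuation

section Birational

theorem isFractionRing_of_isScalarTower {R A K : Type*} [CommRing R] [CommRing A] [Field K]
    [Algebra R A] [Algebra A K] [Algebra R K] [IsScalarTower R A K] [IsFractionRing R K]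
    [FaithfulSMul A K] : IsFractionRing A K := by
  refine IsFractionRing.of_field _ _ fun z => ?_
  obtain ⟨g, h, -, rfl⟩ := IsFractionRing.div_surjective (A := R) z
  exact ⟨algebraMap R A g, algebraMap R A h, by simp [← IsScalarTower.algebraMap_apply]⟩

/-- A finitely generated extension with the same fraction field becomes trivial after inverting
a nonzero element. -/
theorem exists_isLocalization_away (R C K : Type*) [CommRing R] [IsDomain R] [CommRing C]
    [IsDomain C] [Field K] [Algebra R C] [Algebra C K] [Algebra R K] [IsScalarTower R C K]
    [IsFractionRing R K] [FaithfulSMul C K] [Algebra.FiniteType R C] :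
    ∃ d : R, d ≠ 0 ∧ IsLocalization.Away d (Localization.Away (algebraMap R C d)) := by
  classical
  obtain ⟨S, hS⟩ := Algebra.FiniteType.out (R := R) (A := C)
  obtain ⟨⟨d, hd⟩, hdS⟩ :=
    IsLocalization.exist_integer_multiples_of_finset (nonZeroDivisors R) (S.image (algebraMap C K))
  have hd0 := nonZeroDivisors.ne_zero hd
  have hCK := FaithfulSMul.algebraMap_injective C K
  have hRC : Function.Injective (algebraMap R C) := by
    have := IsFractionRing.injective R K
    rw [IsScalarTower.algebraMap_eq R C K, RingHom.coe_comp] at this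
    exact this.of_comp
  have key : ∀ c : C, ∃ (n : ℕ) (r : R), algebraMap R C d ^ n * c = algebraMap R C r := by
    intro c
    have hc : c ∈ Algebra.adjoin R (S : Set C) := hS ▸ Algebra.mem_top
    induction hc using Algebra.adjoin_induction with
    | mem x hx =>
      obtain ⟨r, hr⟩ := hdS _ (Finset.mem_image_of_mem _ hx)
      refine ⟨1, r, hCK ?_⟩
      rw [← IsScalarTower.algebraMap_apply, hr, Algebra.smul_def, pow_one, map_mul,
        ← IsScalarTower.algebraMap_apply]
    | algebraMap r => exact ⟨0, r, by simp⟩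
    | add x y _ _ hx hy =>
      obtain ⟨n, r, hr⟩ := hx
      obtain ⟨m, t, ht⟩ := hy
      refine ⟨n + m, d ^ m * r + d ^ n * t, ?_⟩
      simp only [map_add, map_mul, map_pow, ← hr, ← ht]
      ring
    | mul x y _ _ hx hy =>
      obtain ⟨n, r, hr⟩ := hx
      obtain ⟨m, t, ht⟩ := hy
      refine ⟨n + m, r * t, ?_⟩
      simp only [map_mul, ← hr, ← ht]
      ring
  have hdC : algebraMap R C d ≠ 0 := by simpa using hRC.ne hd0
  refine ⟨d, hd0, ?_⟩
  have hT : ∀ r, algebraMap R (Localization.Away (algebraMap R C d)) r =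
      algebraMap C _ (algebraMap R C r) := IsScalarTower.algebraMap_apply R C _
  have hinj : Function.Injective (algebraMap R (Localization.Away (algebraMap R C d))) := by
    rw [IsScalarTower.algebraMap_eq R C (Localization.Away (algebraMap R C d)), RingHom.coe_comp]
    exact (IsLocalization.injective _ (powers_le_nonZeroDivisors_of_noZeroDivisors hdC)).comp hRC
  refine IsLocalization.Away.mk d ?_ (fun z => ?_) fun a b hab => ⟨0, by rw [hinj hab]⟩
  · rw [hT]
    exact IsLocalization.Away.algebraMap_isUnit _
  · obtain ⟨n, c, hc⟩ := IsLocalization.Away.surj (algebraMap R C d) z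
    obtain ⟨m, r, hr⟩ := key c
    refine ⟨n + m, r, ?_⟩
    rw [hT r, ← hr, map_mul, ← hc, map_pow, hT d]
    ring

end Birational

section BlowUp

variable {R₀ : Type*} (K : Type*) [CommRing R₀] [Field K] [Algebra R₀ K]

/-- The chart `R₀[𝔪 / a]` of the blow-up of the ideal `𝔪` of `R₀` on which `a ∈ 𝔪`
generates the exceptional divisor. -/
def blowUpChart (I : Ideal R₀) (a : R₀) : Subalgebra R₀ K :=
  Algebra.adjoin R₀ ((((algebraMap R₀ K a)⁻¹ • Algebra.linearMap R₀ K : R₀ →ₗ[R₀] K)) '' I)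

theorem blowUpChart_fg {I : Ideal R₀} (hI : I.FG) (a : R₀) : (blowUpChart K I a).FG := by
  obtain ⟨S, rfl⟩ := hI
  classical
  refine ⟨S.image ((algebraMap R₀ K a)⁻¹ • Algebra.linearMap R₀ K : R₀ →ₗ[R₀] K), ?_⟩
  rw [blowUpChart, ← Submodule.map_coe, Submodule.map_span, Algebra.adjoin_span, Finset.coe_image]

variable {K} in
theorem div_pow_mem_blowUpChart {I : Ideal R₀} {a : R₀} (n : ℕ) {z : R₀} (hz : z ∈ I ^ n) :
    algebraMap R₀ K z / algebraMap R₀ K a ^ n ∈ blowUpChart K I a := by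
  induction n generalizing z with
  | zero => simp
  | succ n ih =>
    rw [pow_succ] at hz
    refine Submodule.mul_induction_on hz (fun b hb c hc => ?_) fun b c hb hc => ?_
    · rw [map_mul, pow_succ, mul_div_mul_comm]
      refine mul_mem (ih hb) (Algebra.subset_adjoin ⟨c, hc, ?_⟩)
      simp [div_eq_inv_mul]
    · rw [map_add, add_div]
      exact add_mem hb hc

variable {R : Type*} [CommRing R] [IsLocalRing R] [IsNoetherianRing R] [IsDomain R]
  (hmul : ∀ g h : R, mult R (g * h) = mult R g + mult R h)
  [Algebra R K] [IsFractionRing R K] [Algebra R₀ R] [IsScalarTower R₀ R K]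
  {m₀ : Ideal R₀} [m₀.IsPrime] [IsLocalization.AtPrime R m₀]
  {a : R₀} (ha : mult R (algebraMap R₀ R a) = 1)

include ha in
theorem mem_orderValuationSubring_of_mem_blowUpChart {z : K} (hz : z ∈ blowUpChart K m₀ a) :
    z ∈ orderValuationSubring hmul K := by
  induction hz using Algebra.adjoin_induction with
  | mem x hx =>
    obtain ⟨c, hc, rfl⟩ := hx
    have : ((algebraMap R₀ K a)⁻¹ • Algebra.linearMap R₀ K : R₀ →ₗ[R₀] K) c =
        algebraMap R K (algebraMap R₀ R c) / algebraMap R K (algebraMap R₀ R a) := by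
      simp [div_eq_inv_mul, ← IsScalarTower.algebraMap_apply]
    rw [this, div_mem_orderValuationSubring_iff, ha, ← Nat.cast_one, le_mult_iff, pow_one]
    · exact (IsLocalization.AtPrime.to_map_mem_maximal_iff R m₀ c).mpr hc
    · rintro h
      rw [h, mult_zero] at ha
      simp at ha
  | algebraMap r =>
    rw [IsScalarTower.algebraMap_apply R₀ R K]
    exact algebraMap_mem_orderValuationSubring hmul _
  | add x y _ _ hx hy => exact add_mem hx hy
  | mul x y _ _ hx hy => exact mul_mem hx hy

include ha in
/-- The valuation ring of the order is a localization of the chart: each of its elements is a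
fraction of elements of the chart whose denominator is a unit of the valuation ring. -/
theorem exists_mul_eq_of_mem_orderValuationSubring {z : K} (hz : z ∈ orderValuationSubring hmul K) :
    ∃ c ∈ blowUpChart K m₀ a, ∃ d ∈ blowUpChart K m₀ a,
      d⁻¹ ∈ orderValuationSubring hmul K ∧ d ≠ 0 ∧ z * d = c := by
  obtain ⟨g, h, hh, hgh, rfl⟩ := hz
  obtain ⟨n, hn⟩ := ENat.ne_top_iff_exists.mp (mt mult_eq_top_iff.mp hh)
  have hmem : ∀ g : R, (n : ℕ∞) ≤ mult R g → ∃ s : R₀, s ∉ m₀ ∧ ∃ g₀ ∈ m₀ ^ n,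
      g * algebraMap R₀ R s = algebraMap R₀ R g₀ := by
    intro g hg
    rw [le_mult_iff, ← IsLocalization.AtPrime.map_eq_maximalIdeal m₀ R, ← Ideal.map_pow,
      IsLocalization.mem_map_algebraMap_iff m₀.primeCompl] at hg
    obtain ⟨⟨⟨g₀, hg₀⟩, ⟨s, hs⟩⟩, he⟩ := hg
    exact ⟨s, hs, g₀, hg₀, he⟩
  -- Multiplying `g` and `h` by units of `R` brings both into `m₀ ^ n`, with `n` the order of `h`;
  -- dividing both by `a ^ n` then gives elements of the chart.
  obtain ⟨s, hs, g₀, hg₀, hgs⟩ := hmem g (hn ▸ hgh)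
  obtain ⟨t, ht, h₀, hh₀, hht⟩ := hmem h hn.le
  have hunit : ∀ s : R₀, s ∉ m₀ → IsUnit (algebraMap R₀ R s) := fun s hs =>
    IsLocalization.map_units R (⟨s, hs⟩ : m₀.primeCompl)
  have ha0 : algebraMap R₀ R a ≠ 0 := by
    intro h
    rw [h, mult_zero] at ha
    simp at ha
  have hd0 : h * algebraMap R₀ R t * algebraMap R₀ R s ≠ 0 :=
    mul_ne_zero (mul_ne_zero hh (hunit t ht).ne_zero) (hunit s hs).ne_zero
  have hd : algebraMap R₀ K (h₀ * s) / algebraMap R₀ K a ^ n =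
      algebraMap R K (h * algebraMap R₀ R t * algebraMap R₀ R s) /
        algebraMap R K (algebraMap R₀ R a ^ n) := by
    rw [hht, ← map_mul, map_pow, ← IsScalarTower.algebraMap_apply, ← IsScalarTower.algebraMap_apply]
  refine ⟨_, div_pow_mem_blowUpChart n (Ideal.mul_mem_right t _ hg₀), _,
    div_pow_mem_blowUpChart n (Ideal.mul_mem_right s _ hh₀), ?_, ?_, ?_⟩
  · rw [hd, inv_div, div_mem_orderValuationSubring_iff hmul hd0, hmul, hmul,
      mult_eq_zero_iff.mpr (hunit s hs), mult_eq_zero_iff.mpr (hunit t ht),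
      mult_pow_of_mult_eq_one hmul ha]
    simp [hn]
  · rw [hd]
    simpa [ha0] using hd0
  · rw [hd, IsScalarTower.algebraMap_apply R₀ R K, map_mul (algebraMap R₀ R), ← hgs,
      IsScalarTower.algebraMap_apply R₀ R K a]
    have h1 : algebraMap R K h ≠ 0 := by simpa
    have h2 : algebraMap R K (algebraMap R₀ R a) ≠ 0 := by simpa
    simp only [map_mul, map_pow]
    field_simp

end BlowUp

universe u in
/-- The order on the localization of a finitely generated algebra at a prime `m₀` is, if it is
multiplicative, the valuation of a prime divisor on the normalized blow-up of `m₀`. -/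
theorem exists_normal_finiteType_addVal_eq_mult (k : Type*) {R₀ : Type u} {R : Type*} [Field k]
    [CharZero k] [CommRing R₀] [IsDomain R₀] [Algebra k R₀] [Algebra.FiniteType k R₀] [CommRing R]
    [IsLocalRing R] [IsNoetherianRing R] [IsDomain R] [Algebra R₀ R]
    (hmul : ∀ g h : R, mult R (g * h) = mult R g + mult R h)
    (m₀ : Ideal R₀) [m₀.IsPrime] [IsLocalization.AtPrime R m₀]
    {a : R₀} (ha : mult R (algebraMap R₀ R a) = 1) :
    ∃ (C : Type u) (_ : CommRing C) (_ : IsDomain C) (_ : Algebra R₀ C) (q : Ideal C)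
      (_ : q.IsPrime), Algebra.FiniteType R₀ C ∧ IsIntegrallyClosed C ∧
      (∃ d : R₀, d ≠ 0 ∧ IsLocalization.Away d (Localization.Away (algebraMap R₀ C d))) ∧
      q.comap (algebraMap R₀ C) = m₀ ∧
      ∃ (O : Type u) (_ : CommRing O) (_ : IsDomain O) (_ : IsDiscreteValuationRing O)
        (_ : Algebra C O), IsLocalization.AtPrime O q ∧
        ∀ g : R₀, IsDiscreteValuationRing.addVal O (algebraMap C O (algebraMap R₀ C g)) =
          mult R (algebraMap R₀ R g) := by
  let K := FractionRing R₀
  have hle : m₀.primeCompl ≤ nonZeroDivisors R₀ := m₀.primeCompl_le_nonZeroDivisors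
  let _ : Algebra R K := IsLocalization.localizationAlgebraOfSubmonoidLe R K _ _ hle
  have : IsScalarTower R₀ R K :=
    IsLocalization.localization_isScalarTower_of_submonoid_le R K _ _ hle
  have : IsFractionRing R K :=
    IsFractionRing.isFractionRing_of_isDomain_of_isLocalization m₀.primeCompl R K
  let A := blowUpChart K m₀ a
  have : IsNoetherianRing R₀ := Algebra.FiniteType.isNoetherianRing k R₀
  have hA : Algebra.FiniteType R₀ A :=
    A.fg_iff_finiteType.mp (blowUpChart_fg K (IsNoetherian.noetherian m₀) a)
  have : IsFractionRing A K := isFractionRing_of_isScalarTower (R := R₀)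
  let C := integralClosure A K
  let O := orderValuationSubring hmul K
  have : Module.Finite A C := by
    have : Algebra.FiniteType k A := Algebra.FiniteType.trans ‹_› hA
    exact finite_integralClosure k A K
  -- The valuation ring is integrally closed and contains the chart, hence its normalization.
  have hCO : ∀ c ∈ C, c ∈ O := by
    intro c hc
    have hAO : ∀ z : A, (z : K) ∈ O := fun z =>
      mem_orderValuationSubring_of_mem_blowUpChart K hmul ha z.2
    let _ : Algebra A O := (A.val.toRingHom.codRestrict O.toSubring hAO).toAlgebra
    have : IsScalarTower A O K := .of_algebraMap_eq fun _ => rfl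
    obtain ⟨y, hy⟩ := IsIntegrallyClosed.isIntegral_iff.mp (IsIntegral.tower_top (A := O) hc)
    exact hy ▸ y.2
  have hO := isDiscreteValuationRing_orderValuationSubring (K := K) hmul ha
  let _ : Algebra C O := (C.val.toRingHom.codRestrict O.toSubring fun c => hCO c c.2).toAlgebra
  have hR₀ : ∀ g, algebraMap C O (algebraMap R₀ C g) =
      toOrderValuationSubring hmul (algebraMap R₀ R g) := fun g => by
    ext
    exact IsScalarTower.algebraMap_apply R₀ R K g
  have hval := addVal_toOrderValuationSubring (K := K) hmul ha
  refine ⟨C, inferInstance, inferInstance, inferInstance, (maximalIdeal O).comap (algebraMap C O),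
    inferInstance, .trans hA inferInstance,
    integralClosure.isIntegrallyClosedOfFiniteExtension K, ?_, ?_, O, inferInstance, inferInstance,
    hO, inferInstance, ?_, fun g => ?_⟩
  · have : Algebra.FiniteType R₀ C := .trans hA inferInstance
    exact exists_isLocalization_away R₀ C K
  · ext g
    rw [Ideal.mem_comap, Ideal.mem_comap, hR₀, ← IsLocalization.AtPrime.to_map_mem_maximal_iff R m₀,
      mem_maximalIdeal, mem_maximalIdeal, mem_nonunits_iff, mem_nonunits_iff, not_iff_not,
      ← mult_eq_zero_iff (R := R), ← hval, IsDiscreteValuationRing.addVal_eq_zero_iff]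
  · refine ⟨?_, ?_, ?_⟩
    · rintro ⟨c, hc⟩
      exact not_not.mp hc
    · intro z
      obtain ⟨c, hc, d, hd, hdO, hd0, h⟩ := exists_mul_eq_of_mem_orderValuationSubring K hmul
        (m₀ := m₀) ha z.2
      refine ⟨⟨algebraMap A C ⟨c, hc⟩, algebraMap A C ⟨d, hd⟩, ?_⟩, Subtype.ext h⟩
      exact not_not.mpr (IsUnit.of_mul_eq_one ⟨_, hdO⟩ (Subtype.ext (mul_inv_cancel₀ hd0)))
    · intro x y hxy
      exact ⟨1, congrArg (_ * ·) (Subtype.ext (congrArg (Subtype.val : O → K) hxy))⟩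
  · rw [hR₀, hval]

end Izumi

namespace Izumi

open IsLocalRing

/-! ### Local rings of complex varieties -/

section Stalks

variable {X : Scheme.{0}} (s : X ⟶ Spec (.of ℂ))

/-- The structure map of a local ring as a morphism of bundled rings. -/
theorem ofHom_stalkStructureMap (x : X) : CommRingCat.ofHom (stalkStructureMap s x) =
    (Scheme.ΓSpecIso (.of ℂ)).inv ≫ s.appTop ≫
      X.presheaf.germ ⊤ x (TopologicalSpace.Opens.mem_top x) := rfl

theorem stalkSpecializes_comp_stalkStructureMap {x y : X} (h : x ⤳ y) :
    (X.presheaf.stalkSpecializes h).hom.comp (stalkStructureMap s y) = stalkStructureMap s x := by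
  have : CommRingCat.ofHom (stalkStructureMap s y) ≫ X.presheaf.stalkSpecializes h =
      CommRingCat.ofHom (stalkStructureMap s x) := by
    simp only [ofHom_stalkStructureMap, Category.assoc, TopCat.Presheaf.germ_stalkSpecializes]
  exact congrArg CommRingCat.Hom.hom this

theorem stalkMap_comp_stalkStructureMap {Y : Scheme.{0}} (f : Y ⟶ X) (y : Y) :
    (f.stalkMap y).hom.comp (stalkStructureMap s (f y)) = stalkStructureMap (f ≫ s) y := by
  have : CommRingCat.ofHom (stalkStructureMap s (f y)) ≫ f.stalkMap y =
      CommRingCat.ofHom (stalkStructureMap (f ≫ s) y) := by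
    simp only [ofHom_stalkStructureMap, Category.assoc, Scheme.Hom.germ_stalkMap,
      Scheme.Hom.comp_appTop]
    rfl
  exact congrArg CommRingCat.Hom.hom this

/-- The map from `ℂ` to the local ring of the point `Spec ℂ`. -/
noncomputable def baseStalkMap (p : Spec (.of ℂ)) : ℂ →+* (Spec (.of ℂ)).presheaf.stalk p :=
  ((Scheme.ΓSpecIso (.of ℂ)).inv ≫ (Spec (.of ℂ)).presheaf.germ ⊤ p
    (TopologicalSpace.Opens.mem_top p)).hom

theorem bijective_baseStalkMap (p : PrimeSpectrum ℂ) : Function.Bijective (baseStalkMap p) := by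
  let e := IsLocalization.atUnits ℂ (p.asIdeal.primeCompl)
    (S := (Spec.structureSheaf ℂ).presheaf.stalk p) (fun x hx => by
      rw [IsUnit.mem_submonoid_iff]
      exact IsUnit.mk0 x fun h => hx (h ▸ zero_mem _))
  exact e.bijective

/-- Up to the isomorphism of `ℂ` with the local ring of `Spec ℂ`, the structure map of a local ring
is the stalk map of the structure morphism, so that it inherits the local properties of the
latter. -/
theorem stalkStructureMap_eq (x : X) :
    stalkStructureMap s x = (s.stalkMap x).hom.comp (baseStalkMap (s x)) := by
  have : CommRingCat.ofHom (stalkStructureMap s x) =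
      CommRingCat.ofHom (baseStalkMap (s x)) ≫ s.stalkMap x := by
    rw [ofHom_stalkStructureMap, baseStalkMap, CommRingCat.ofHom_hom, Category.assoc,
      Scheme.Hom.germ_stalkMap]
    rfl
  exact congrArg CommRingCat.Hom.hom this

theorem essFiniteType_stalkStructureMap [LocallyOfFiniteType s] (x : X) :
    (stalkStructureMap s x).EssFiniteType := by
  rw [stalkStructureMap_eq]
  exact (RingHom.FiniteType.of_surjective _ (bijective_baseStalkMap (s x)).2).essFiniteType.comp
    (LocallyOfFiniteType.stalkMap s x)

theorem formallySmooth_stalkStructureMap [LocallyOfFiniteType s] {x : X}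
    (hx : IsSmoothPoint s x) : (stalkStructureMap s x).FormallySmooth := by
  rw [stalkStructureMap_eq]
  have : LocallyOfFinitePresentation s := inferInstance
  obtain ⟨U, hxU, hU⟩ := hx
  refine (RingHom.FormallySmooth.of_bijective (bijective_baseStalkMap (s x))).comp ?_
  have h : (⟨x, hxU⟩ : U) ∈ (U.ι ≫ s).smoothLocus := by
    rw [Scheme.Hom.smoothLocus_eq_top]
    trivial
  rwa [← Scheme.Hom.preimage_smoothLocus_eq] at h

/-- A generization of a smooth point is smooth. -/
theorem IsSmoothPoint.of_specializes {s : X ⟶ Spec (.of ℂ)} {x y : X} (h : x ⤳ y)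
    (hy : IsSmoothPoint s y) : IsSmoothPoint s x := by
  obtain ⟨U, hyU, hU⟩ := hy
  exact ⟨U, h.mem_open U.2 hyU, hU⟩

/-- At a closed point every germ has a value in `ℂ`. -/
theorem exists_sub_stalkStructureMap_mem [LocallyOfFiniteType s] {x : X} (hx : IsClosed {x})
    (g : X.presheaf.stalk x) :
    ∃ c : ℂ, g - stalkStructureMap s x c ∈ maximalIdeal (X.presheaf.stalk x) := by
  -- The isomorphism of `ℂ` with the residue field at a closed point is the structure map.
  have h1 : (residueFieldIsoBase s x hx).inv =
      CommRingCat.ofHom (stalkStructureMap s x) ≫ X.residue x := by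
    apply Spec.map_injective
    have h2 : X.toSpecΓ ≫ Spec.map s.appTop ≫ Spec.map (Scheme.ΓSpecIso (.of ℂ)).inv = s := by
      rw [← Scheme.toSpecΓ_naturality_assoc, ← SpecMap_ΓSpecIso_hom, ← Spec.map_comp,
        Iso.inv_hom_id, Spec.map_id, Category.comp_id]
    rw [SpecMap_residueFieldIsoBase_inv, Spec.map_comp, Scheme.fromSpecResidueField,
      ofHom_stalkStructureMap, Spec.map_comp, Spec.map_comp, ← Scheme.fromSpecStalk_toSpecΓ,
      Category.assoc, Category.assoc, Category.assoc, h2]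
  obtain ⟨c, hc⟩ := (ConcreteCategory.bijective_of_isIso (residueFieldIsoBase s x hx).inv).2
    (X.residue x g)
  refine ⟨c, ?_⟩
  rw [← IsLocalRing.residue_eq_zero_iff, map_sub, sub_eq_zero]
  rw [h1] at hc
  exact hc.symm

end Stalks

section Localization

/-- The local ring at a generization is a localization. -/
theorem exists_isLocalization_stalkSpecializes (X : Scheme.{0}) {x y : X} (h : x ⤳ y) :
    letI := (X.presheaf.stalkSpecializes h).hom.toAlgebra
    ∃ M : Submonoid (X.presheaf.stalk y), IsLocalization M (X.presheaf.stalk x) := by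
  obtain ⟨_, ⟨U, hU, rfl⟩, hyU, -⟩ :=
    X.isBasis_affineOpens.exists_subset_of_mem_open (Set.mem_univ y) isOpen_univ
  have hxU : x ∈ U := h.mem_open U.2 hyU
  let _ := (X.presheaf.stalkSpecializes h).hom.toAlgebra
  let _ := X.presheaf.algebra_section_stalk (⟨x, hxU⟩ : U)
  let _ := X.presheaf.algebra_section_stalk (⟨y, hyU⟩ : U)
  have hx := hU.isLocalization_stalk ⟨x, hxU⟩
  have hy := hU.isLocalization_stalk ⟨y, hyU⟩
  have : IsScalarTower Γ(X, U) (X.presheaf.stalk y) (X.presheaf.stalk x) :=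
    .of_algebraMap_eq' (by
      have := X.presheaf.germ_stalkSpecializes (U := U) hyU h
      exact (congrArg CommRingCat.Hom.hom this).symm)
  refine ⟨_, IsLocalization.isLocalization_of_submonoid_le (X.presheaf.stalk y)
    (X.presheaf.stalk x) (hU.primeIdealOf ⟨y, hyU⟩).asIdeal.primeCompl
    (hU.primeIdealOf ⟨x, hxU⟩).asIdeal.primeCompl fun f hf => ?_⟩
  have h1 := (IsLocalization.map_units (X.presheaf.stalk y) ⟨f, hf⟩).map
    (algebraMap (X.presheaf.stalk y) (X.presheaf.stalk x))
  rw [← IsScalarTower.algebraMap_apply] at h1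
  exact (IsLocalization.AtPrime.isUnit_to_map_iff _ _ f).mp h1

/-- A birational morphism induces an isomorphism of function fields, so that the local ring at the
image of a point has the same fraction field as the local ring at the point. -/
theorem isFractionRing_of_birational {X Y : Scheme.{0}} [IsIntegral X] [IsIntegral Y] (f : Y ⟶ X)
    (V : Y.Opens) (hV : (V : Set Y).Nonempty) [IsOpenImmersion (V.ι ≫ f)] (y : Y) :
    letI := (f.stalkMap y ≫
      Y.presheaf.stalkSpecializes ((genericPoint_spec Y).specializes trivial)).hom.toAlgebra
    IsFractionRing (X.presheaf.stalk (f y)) Y.functionField := by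
  have hξ : genericPoint Y ∈ V :=
    ((genericPoint_spec Y).mem_open_set_iff V.isOpen).mpr (by simpa using hV)
  have : Nonempty V := hV.to_subtype
  have hf : f (genericPoint Y) = genericPoint X := by
    rw [← genericPoint_eq_of_isOpenImmersion V.ι, ← genericPoint_eq_of_isOpenImmersion (V.ι ≫ f)]
    rfl
  have hiso : IsIso (f.stalkMap (genericPoint Y)) := by
    let v : V.toScheme := ⟨genericPoint Y, hξ⟩
    have h1 : IsIso (f.stalkMap (V.ι v) ≫ V.ι.stalkMap v) := by
      have := (inferInstance : IsIso ((V.ι ≫ f).stalkMap v))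
      rwa [Scheme.Hom.stalkMap_comp] at this
    exact IsIso.of_isIso_comp_right (f.stalkMap (V.ι v)) (V.ι.stalkMap v)
  have hX : ∀ (p : X) (hp : p = genericPoint X) (h : p ⤳ f y),
      letI := (X.presheaf.stalkSpecializes h).hom.toAlgebra
      IsFractionRing (X.presheaf.stalk (f y)) (X.presheaf.stalk p) := by
    rintro _ rfl h
    exact inferInstanceAs (IsFractionRing (X.presheaf.stalk (f y)) X.functionField)
  have hsp : genericPoint Y ⤳ y := (genericPoint_spec Y).specializes trivial
  have hsq := Scheme.Hom.stalkSpecializes_stalkMap f _ _ hsp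
  let _ := (X.presheaf.stalkSpecializes (hsp.map f.continuous)).hom.toAlgebra
  let _ := (f.stalkMap y ≫ Y.presheaf.stalkSpecializes hsp).hom.toAlgebra
  have := hX _ hf (hsp.map f.continuous)
  let e : X.presheaf.stalk (f (genericPoint Y)) ≃ₐ[X.presheaf.stalk (f y)] Y.functionField :=
    AlgEquiv.ofRingEquiv (f := (asIso (f.stalkMap (genericPoint Y))).commRingCatIsoToRingEquiv)
      fun r => congr($(hsq).hom r)
  exact IsLocalization.isLocalization_of_algEquiv _ e

end Localization

end Izumi

namespace Izumi

open IsLocalRing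

/-! ### Divisors over a complex variety -/

namespace DivisorOver

variable {X : Scheme.{0}} {s : X ⟶ Spec (.of ℂ)} (E : DivisorOver s) {x : X}

/-- The local ring at the generic point of the center has the function field of the model as its
fraction field. -/
theorem isFractionRing_functionField [IsIntegral X] :
    letI := (E.f.stalkMap E.η ≫ E.Y.presheaf.stalkSpecializes
      ((genericPoint_spec E.Y).specializes trivial)).hom.toAlgebra
    IsFractionRing (X.presheaf.stalk (E.f E.η)) E.Y.functionField := by
  obtain ⟨V, hV, hf⟩ := E.birational
  exact isFractionRing_of_birational E.f V hV E.η

/-- A smooth closed point has local coordinates whose differentials form a basis. -/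
theorem exists_localCoordinates_stalk (hX : IsVariety s) (hx : IsClosed {x})
    (hsm : IsSmoothPoint s x) :
    letI := (stalkStructureMap s x).toAlgebra
    ∃ (𝒞 : LocalCoordinates ℂ (X.presheaf.stalk x)
        (Fin (Module.finrank (X.presheaf.stalk x) Ω[X.presheaf.stalk x⁄ℂ])))
      (b : Module.Basis _ (X.presheaf.stalk x) Ω[X.presheaf.stalk x⁄ℂ]),
      ∀ i, b i = KaehlerDifferential.D ℂ (X.presheaf.stalk x) (𝒞.y i) := by
  have := hX.locallyOfFiniteType
  have : IsLocallyNoetherian X := LocallyOfFiniteType.isLocallyNoetherian s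
  let _ := (stalkStructureMap s x).toAlgebra
  have : Algebra.EssFiniteType ℂ (X.presheaf.stalk x) := essFiniteType_stalkStructureMap s x
  have : Algebra.FormallySmooth ℂ (X.presheaf.stalk x) := formallySmooth_stalkStructureMap s hsm
  exact exists_localCoordinates (exists_sub_stalkStructureMap_mem s hx)

/-- The upper bound for the valuation, together with the positivity of the discrepancy. -/
theorem val_le_and_one_le_discrepancy (hX : IsVariety s) (hx : IsClosed {x})
    (hsm : IsSmoothPoint s x) (hE : x ∈ E.center) (hc : 2 ≤ Order.coheight E.centerPt) :
    1 ≤ E.discrepancy ∧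
      ∀ g, E.val hE g ≤ (E.discrepancy : ℕ∞) * mult (X.presheaf.stalk x) g := by
  have := hX.isIntegral
  have := hX.locallyOfFiniteType
  have : LocallyOfFiniteType (E.f ≫ s) := E.isVariety.locallyOfFiniteType
  have : IsLocallyNoetherian X := LocallyOfFiniteType.isLocallyNoetherian s
  have hsp : E.centerPt ⤳ x := specializes_iff_mem_closure.mpr hE
  let R := X.presheaf.stalk x
  let A := X.presheaf.stalk E.centerPt
  let B := E.Y.presheaf.stalk E.η
  let L := E.Y.functionField
  let _ : Algebra ℂ R := (stalkStructureMap s x).toAlgebra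
  let _ : Algebra ℂ A := (stalkStructureMap s E.centerPt).toAlgebra
  let _ : Algebra ℂ B := (stalkStructureMap (E.f ≫ s) E.η).toAlgebra
  let _ : Algebra A B := (E.f.stalkMap E.η).hom.toAlgebra
  let _ : Algebra R A := (X.presheaf.stalkSpecializes hsp).hom.toAlgebra
  let _ : Algebra R B := (E.stalkHom hE).toAlgebra
  let _ : Algebra A L := (E.f.stalkMap E.η ≫ E.Y.presheaf.stalkSpecializes
      ((genericPoint_spec E.Y).specializes trivial)).hom.toAlgebra
  let _ : Algebra ℂ L := ((algebraMap B L).comp (algebraMap ℂ B)).toAlgebra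
  have : IsScalarTower A B L := .of_algebraMap_eq' rfl
  have : IsScalarTower R A B := .of_algebraMap_eq' rfl
  have : IsScalarTower ℂ R A :=
    .of_algebraMap_eq' (stalkSpecializes_comp_stalkStructureMap s hsp).symm
  have : IsScalarTower ℂ A B := .of_algebraMap_eq' (stalkMap_comp_stalkStructureMap s E.f E.η).symm
  have : IsScalarTower ℂ B L := .of_algebraMap_eq' rfl
  have : IsScalarTower ℂ A L := .of_algebraMap_eq' (by
    rw [IsScalarTower.algebraMap_eq A B L, RingHom.comp_assoc, ← IsScalarTower.algebraMap_eq ℂ A B]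
    rfl)
  have : IsFractionRing A L := E.isFractionRing_functionField
  have : Algebra.EssFiniteType ℂ A := essFiniteType_stalkStructureMap s _
  have : Algebra.EssFiniteType ℂ B := essFiniteType_stalkStructureMap (E.f ≫ s) _
  have : Algebra.FormallySmooth ℂ A := formallySmooth_stalkStructureMap s (.of_specializes hsp hsm)
  have : IsLocalHom (algebraMap A B) := inferInstanceAs (IsLocalHom (E.f.stalkMap E.η).hom)
  have hA : 2 ≤ ringKrullDim A := by
    rw [ringKrullDim_stalk_eq_coheight]
    exact WithBot.coe_le_coe.mpr hc
  obtain ⟨M, hM⟩ := exists_isLocalization_stalkSpecializes X hsp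
  obtain ⟨𝒞, -⟩ := exists_localCoordinates_stalk hX hx hsm
  exact ⟨one_le_jacobianOrder L hA, addVal_le_jacobianOrder_mul_mult L M 𝒞 hA⟩

theorem mult_mul_stalk (hX : IsVariety s) (hx : IsClosed {x}) (hsm : IsSmoothPoint s x)
    (g h : X.presheaf.stalk x) : mult (X.presheaf.stalk x) (g * h) =
      mult (X.presheaf.stalk x) g + mult (X.presheaf.stalk x) h := by
  have := hX.locallyOfFiniteType
  have : IsLocallyNoetherian X := LocallyOfFiniteType.isLocallyNoetherian s
  let _ := (stalkStructureMap s x).toAlgebra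
  obtain ⟨𝒞, -⟩ := exists_localCoordinates_stalk hX hx hsm
  exact 𝒞.mult_mul g h

/-- A valuation which equals the order at `x` has center `x`. -/
theorem centerPt_eq_of_val_eq_mult (hE : x ∈ E.center)
    (hv : ∀ g, E.val hE g = mult (X.presheaf.stalk x) g) : E.centerPt = x := by
  have hsp : E.centerPt ⤳ x := specializes_iff_mem_closure.mpr hE
  -- Elements of value zero are those of order zero, the units, so that the localization map from
  -- `𝒪_{X,x}` to the local ring at the center is local.
  have hloc : IsLocalHom (X.presheaf.stalkSpecializes hsp).hom := ⟨fun g hg => by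
    rw [← mult_eq_zero_iff, ← hv]
    exact IsDiscreteValuationRing.addVal_eq_zero_iff.mpr (hg.map (E.f.stalkMap E.η).hom)⟩
  have h := Scheme.SpecMap_stalkSpecializes_fromSpecStalk hsp
  have h1 : X.fromSpecStalk x (Spec.map (X.presheaf.stalkSpecializes hsp)
      (closedPoint (X.presheaf.stalk E.centerPt))) = E.centerPt :=
    congr($h (closedPoint (X.presheaf.stalk E.centerPt))).trans Scheme.fromSpecStalk_closedPoint
  have h2 : Spec.map (X.presheaf.stalkSpecializes hsp) (closedPoint (X.presheaf.stalk E.centerPt)) =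
    closedPoint (X.presheaf.stalk x) := comap_closedPoint (X.presheaf.stalkSpecializes hsp).hom
  exact h1.symm.trans ((congrArg (X.fromSpecStalk x) h2).trans Scheme.fromSpecStalk_closedPoint)

/-- On a surface, a divisor whose valuation is the order at a smooth point has discrepancy at most
one. -/
theorem discrepancy_le_one (hX : IsVariety s) (hx : IsClosed {x}) (hsm : IsSmoothPoint s x)
    (hdim : Order.coheight x = 2) (hE : x ∈ E.center)
    (hv : ∀ g, E.val hE g = mult (X.presheaf.stalk x) g) : E.discrepancy ≤ 1 := by
  obtain rfl := E.centerPt_eq_of_val_eq_mult hE hv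
  have := hX.isIntegral
  have := hX.locallyOfFiniteType
  have : LocallyOfFiniteType (E.f ≫ s) := E.isVariety.locallyOfFiniteType
  have : IsLocallyNoetherian X := LocallyOfFiniteType.isLocallyNoetherian s
  obtain ⟨𝒞, b, hb⟩ := exists_localCoordinates_stalk hX hx hsm
  let A := X.presheaf.stalk E.centerPt
  let B := E.Y.presheaf.stalk E.η
  let L := E.Y.functionField
  let _ : Algebra ℂ A := (stalkStructureMap s E.centerPt).toAlgebra
  let _ : Algebra ℂ B := (stalkStructureMap (E.f ≫ s) E.η).toAlgebra
  let _ : Algebra A B := (E.f.stalkMap E.η).hom.toAlgebra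
  let _ : Algebra A L := (E.f.stalkMap E.η ≫ E.Y.presheaf.stalkSpecializes
      ((genericPoint_spec E.Y).specializes trivial)).hom.toAlgebra
  let _ : Algebra ℂ L := ((algebraMap B L).comp (algebraMap ℂ B)).toAlgebra
  have : IsScalarTower A B L := .of_algebraMap_eq' rfl
  have : IsScalarTower ℂ A B := .of_algebraMap_eq' (stalkMap_comp_stalkStructureMap s E.f E.η).symm
  have : IsScalarTower ℂ B L := .of_algebraMap_eq' rfl
  have : IsScalarTower ℂ A L := .of_algebraMap_eq' (by
    rw [IsScalarTower.algebraMap_eq A B L, RingHom.comp_assoc, ← IsScalarTower.algebraMap_eq ℂ A B]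
    rfl)
  have : IsFractionRing A L := E.isFractionRing_functionField
  have : Algebra.EssFiniteType ℂ B := essFiniteType_stalkStructureMap (E.f ≫ s) _
  have hA : ringKrullDim A = (2 : ℕ) := by
    rw [ringKrullDim_stalk_eq_coheight, hdim]
    rfl
  refine jacobianOrder_le_one L (fun g => ?_) (𝒞.finrank_eq hA) 𝒞 b hb
  rw [← hv, val, stalkHom, TopCat.Presheaf.stalkSpecializes_refl]
  rfl

theorem val_mul (hE : x ∈ E.center) (a b : X.presheaf.stalk x) :
    E.val hE (a * b) = E.val hE a + E.val hE b := by
  rw [val, map_mul]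
  exact IsDiscreteValuationRing.addVal_mul

/-- The lower bound for the valuation. -/
theorem valMaximalIdeal_mul_mult_le [IsLocallyNoetherian X] (hE : x ∈ E.center)
    (g : X.presheaf.stalk x) :
    E.valMaximalIdeal hE * mult (X.presheaf.stalk x) g ≤ E.val hE g := by
  have hpow : ∀ (n : ℕ) (g), g ∈ maximalIdeal (X.presheaf.stalk x) ^ n →
      E.valMaximalIdeal hE * n ≤ E.val hE g := by
    intro n
    induction n with
    | zero => simp
    | succ n ih =>
      intro g hg
      rw [pow_succ] at hg
      refine Submodule.mul_induction_on hg (fun a ha b hb => ?_) fun a b ha hb => ?_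
      · rw [val_mul, Nat.cast_add_one, mul_add, mul_one]
        exact add_le_add (ih a ha) (iInf₂_le b hb)
      · refine (le_min ha hb).trans ?_
        rw [val, val, val, map_add]
        exact IsDiscreteValuationRing.addVal_add
  by_cases hg : mult (X.presheaf.stalk x) g = ⊤
  · obtain rfl := mult_eq_top_iff.mp hg
    have : E.val hE 0 = ⊤ := by
      rw [val, map_zero]
      exact IsDiscreteValuationRing.addVal_zero
    rw [this]
    exact le_top
  · obtain ⟨n, hn⟩ := ENat.ne_top_iff_exists.mp hg
    rw [← hn]
    exact hpow n g (le_mult_iff.mp hn.le)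

end DivisorOver

end Izumi

namespace Izumi

open IsLocalRing

/-! ### The exceptional divisor of the blow-up of a smooth point -/

theorem addVal_ringEquiv {A B : Type*} [CommRing A] [IsDomain A] [IsDiscreteValuationRing A]
    [CommRing B] [IsDomain B] [IsDiscreteValuationRing B] (e : A ≃+* B) (x : A) :
    IsDiscreteValuationRing.addVal B (e x) = IsDiscreteValuationRing.addVal A x := by
  by_cases hx : x = 0
  · simp [hx]
  obtain ⟨t, ht⟩ := IsDiscreteValuationRing.exists_irreducible A
  obtain ⟨n, u, rfl⟩ := IsDiscreteValuationRing.eq_unit_mul_pow_irreducible hx ht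
  have ht' : Irreducible (e t) := (MulEquiv.irreducible_iff e).mpr ht
  rw [IsDiscreteValuationRing.addVal_def _ u ht n rfl,
    IsDiscreteValuationRing.addVal_def _ (Units.map e u) ht' n (by simp)]

theorem isIntegrallyClosed_stalk_Spec (C : Type) [CommRing C] [IsDomain C] [IsIntegrallyClosed C]
    (p : PrimeSpectrum C) : IsIntegrallyClosed ((Spec (.of C)).presheaf.stalk p) := by
  let _ := (inferInstance : Algebra C ((Spec.structureSheaf C).presheaf.stalk p))
  have h : IsLocalization.AtPrime ((Spec.structureSheaf C).presheaf.stalk p) p.asIdeal :=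
    StructureSheaf.IsLocalization.to_stalk C p
  exact isIntegrallyClosed_of_isLocalization (R := C)
    ((Spec.structureSheaf C).presheaf.stalk p) p.asIdeal.primeCompl
    p.asIdeal.primeCompl_le_nonZeroDivisors

theorem isVariety_SpecMap_fromSpec {X : Scheme.{0}} {s : X ⟶ Spec (.of ℂ)} (hX : IsVariety s)
    {U : X.Opens} (hU : IsAffineOpen U) {C : Type} [CommRing C] [IsDomain C]
    (φ : Γ(X, U) →+* C) (hφ : φ.FiniteType) :
    IsVariety ((Spec.map (CommRingCat.ofHom φ) ≫ hU.fromSpec) ≫ s) := by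
  have := hX.isSeparated
  have := hX.locallyOfFiniteType
  have : LocallyOfFiniteType (Spec.map (CommRingCat.ofHom φ)) :=
    HasRingHomProperty.Spec_iff.mpr hφ
  have : IsIntegral (Spec (CommRingCat.of C)) := inferInstance
  exact ⟨inferInstance, inferInstance, inferInstance, inferInstance⟩

/-- A morphism of affine schemes which becomes an isomorphism after inverting `d`, followed by an
open immersion, restricts to an open immersion on the locus where `d` does not vanish. -/
theorem isOpenImmersion_ι_comp {R C : Type} [CommRing R] [CommRing C] [Algebra R C]
    {X : Scheme.{0}} (g : Spec (.of R) ⟶ X) [IsOpenImmersion g] (d : R)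
    [IsLocalization.Away d (Localization.Away (algebraMap R C d))] :
    IsOpenImmersion ((Spec.map (CommRingCat.ofHom (algebraMap C
      (Localization.Away (algebraMap R C d))))).opensRange.ι ≫
        Spec.map (CommRingCat.ofHom (algebraMap R C)) ≫ g) := by
  set h := Spec.map (CommRingCat.ofHom (algebraMap C (Localization.Away (algebraMap R C d))))
  have h1 : IsOpenImmersion (h ≫ Spec.map (CommRingCat.ofHom (algebraMap R C))) := by
    rw [← Spec.map_comp, ← CommRingCat.ofHom_comp, ← IsScalarTower.algebraMap_eq]
    exact IsOpenImmersion.of_isLocalization d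
  rw [← h.isoOpensRange_inv_comp, Category.assoc, ← Category.assoc h]
  infer_instance

/-- On germs of functions on an affine open `U`, a morphism to `U` given by a ring homomorphism `φ`
acts through `φ`. -/
theorem germ_comp_stalkMap_SpecMap_fromSpec {X : Scheme.{0}} {U : X.Opens} (hU : IsAffineOpen U)
    {C : CommRingCat.{0}} (φ : Γ(X, U) ⟶ C) (p : Spec C)
    (hp : (Spec.map φ ≫ hU.fromSpec) p ∈ U) :
    X.presheaf.germ U _ hp ≫ (Spec.map φ ≫ hU.fromSpec).stalkMap p =
      φ ≫ (Scheme.ΓSpecIso C).inv ≫ (Spec C).presheaf.germ ⊤ p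
        (TopologicalSpace.Opens.mem_top p) := by
  have h1 := Scheme.Hom.germ_stalkMap hU.fromSpec U (Spec.map φ p) hp
  have h2 := Scheme.Hom.germ_stalkMap (Spec.map φ) ⊤ p (TopologicalSpace.Opens.mem_top _)
  rw [Scheme.Hom.stalkMap_comp]
  refine ((reassoc_of% h1) ((Spec.map φ).stalkMap p)).trans ?_
  have h3 := (Spec Γ(X, U)).presheaf.germ_res (homOfLE le_top : hU.fromSpec ⁻¹ᵁ U ⟶ ⊤)
    (Spec.map φ p) hp
  rw [hU.fromSpec_app_self, Scheme.ΓSpecIso_inv_naturality_assoc]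
  exact congrArg ((Scheme.ΓSpecIso _).inv ≫ ·)
    (((reassoc_of% h3) ((Spec.map φ).stalkMap p)).trans h2)

/-- The order at a smooth closed point of a surface is the valuation of the exceptional divisor of
the normalized blow-up of the point. -/
theorem exists_divisorOver_val_eq_mult {X : Scheme.{0}} {s : X ⟶ Spec (.of ℂ)} (hX : IsVariety s)
    {x : X} (hx : IsClosed {x}) (hsm : IsSmoothPoint s x) (hdim : Order.coheight x = 2) :
    ∃ (E : DivisorOver s) (hE : x ∈ E.center), E.centerPt = x ∧
      ∀ g : X.presheaf.stalk x, E.val hE g = mult (X.presheaf.stalk x) g := by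
  have := hX.isIntegral
  have := hX.locallyOfFiniteType
  have : IsLocallyNoetherian X := LocallyOfFiniteType.isLocallyNoetherian s
  have hmul := DivisorOver.mult_mul_stalk hX hx hsm
  obtain ⟨_, ⟨U, hU, rfl⟩, hxU, -⟩ :=
    X.isBasis_affineOpens.exists_subset_of_mem_open (Set.mem_univ x) isOpen_univ
  have : Nonempty U := ⟨⟨x, hxU⟩⟩
  let R₀ : Type := Γ(X, U)
  let R : Type := X.presheaf.stalk x
  let _ : Algebra R₀ R := X.presheaf.algebra_section_stalk (⟨x, hxU⟩ : U)
  let m₀ := (hU.primeIdealOf ⟨x, hxU⟩).asIdeal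
  have hloc : IsLocalization.AtPrime R m₀ := hU.isLocalization_stalk ⟨x, hxU⟩
  let ψ := (Scheme.ΓSpecIso (.of ℂ)).inv ≫ s.appLE ⊤ U le_top
  let _ : Algebra ℂ R₀ := ψ.hom.toAlgebra
  have : Algebra.FiniteType ℂ R₀ :=
    (s.finiteType_appLE (isAffineOpen_top _) hU le_top).comp (.of_surjective _
      (ConcreteCategory.bijective_of_isIso (Scheme.ΓSpecIso (.of ℂ)).inv).2)
  -- Clearing the denominator of a coordinate, a unit, gives an element of order one of `R₀`.
  obtain ⟨a, ha⟩ : ∃ a : R₀, mult R (algebraMap R₀ R a) = 1 := by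
    let _ := (stalkStructureMap s x).toAlgebra
    obtain ⟨𝒞, -⟩ := DivisorOver.exists_localCoordinates_stalk hX hx hsm
    have hn := 𝒞.finrank_eq (d := 2) (by rw [ringKrullDim_stalk_eq_coheight, hdim]; rfl)
    obtain ⟨⟨a, t⟩, h⟩ := IsLocalization.surj m₀.primeCompl (𝒞.y ⟨0, by omega⟩)
    refine ⟨a, ?_⟩
    rw [← h, hmul, 𝒞.mult_y, mult_eq_zero_iff.mpr (IsLocalization.map_units R t)]
    rfl
  obtain ⟨C, _, _, _, q, _, hfin, hC, ⟨d, hd, hdC⟩, hq, O, _, _, _, _, hO, hval⟩ :=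
    exists_normal_finiteType_addVal_eq_mult ℂ hmul m₀ ha
  let φ : Γ(X, U) ⟶ .of C := CommRingCat.ofHom (algebraMap R₀ C)
  let η : Spec (.of C) := ⟨q, inferInstance⟩
  let _ : Algebra C ((Spec (.of C)).presheaf.stalk η) :=
    ((Scheme.ΓSpecIso (.of C)).inv ≫ (Spec (.of C)).presheaf.germ ⊤ η
        (TopologicalSpace.Opens.mem_top η)).hom.toAlgebra
  have hη : IsLocalization.AtPrime ((Spec (.of C)).presheaf.stalk η) q :=
    StructureSheaf.IsLocalization.to_stalk C η
  let e : (Spec (.of C)).presheaf.stalk η ≃ₐ[C] O := IsLocalization.algEquiv q.primeCompl _ _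
  have hopen : IsOpenImmersion (X := Spec (.of R₀)) hU.fromSpec := hU.isOpenImmersion_fromSpec
  have hdom : IsDomain (Localization.Away (algebraMap R₀ C d)) :=
    IsLocalization.Away.isDomain _ hd
  have hdvr : IsDiscreteValuationRing ((Spec (.of C)).presheaf.stalk η) :=
    IsDiscreteValuationRing.RingEquivClass.isDiscreteValuationRing e.symm
  let E : DivisorOver s :=
    { Y := Spec (.of C)
      f := Spec.map φ ≫ hU.fromSpec
      isVariety := isVariety_SpecMap_fromSpec hX hU _ (RingHom.finiteType_algebraMap.mpr hfin)
      normal := isIntegrallyClosed_stalk_Spec C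
      birational := ⟨_, Set.range_nonempty _, isOpenImmersion_ι_comp hU.fromSpec d⟩
      η := η
      codim_one := by
        apply WithBot.coe_injective
        rw [← ringKrullDim_stalk_eq_coheight, ringKrullDim_eq_of_ringEquiv e.toRingEquiv,
          IsDiscreteValuationRing.ringKrullDim_eq_one O]
        rfl }
  have hcenter : E.centerPt = x :=
    (congrArg hU.fromSpec (PrimeSpectrum.ext hq)).trans (hU.fromSpec_primeIdealOf ⟨x, hxU⟩)
  have hE : x ∈ E.center := hcenter ▸ subset_closure rfl
  have hsp : E.centerPt ⤳ x := specializes_iff_mem_closure.mpr hE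
  have hvalR₀ : ∀ g : R₀, E.val hE (algebraMap R₀ R g) = mult R (algebraMap R₀ R g) := fun g => by
    have h1 : E.stalkHom hE (algebraMap R₀ R g) =
        algebraMap C ((Spec (.of C)).presheaf.stalk η) (algebraMap R₀ C g) := by
      have h2 := germ_comp_stalkMap_SpecMap_fromSpec hU φ η (hsp.mem_open U.2 hxU)
      have h3 := X.presheaf.germ_stalkSpecializes hxU hsp
      exact (congrArg (E.f.stalkMap E.η).hom congr($(h3).hom g)).trans congr($(h2).hom g)
    rw [← hval, DivisorOver.val, h1, ← e.commutes]
    exact (addVal_ringEquiv e.toRingEquiv _).symm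
  -- Both sides are additive and agree on `R₀`, of which `R` is a localization.
  refine ⟨E, hE, hcenter, fun g => ?_⟩
  obtain ⟨⟨a, t⟩, h⟩ := IsLocalization.surj m₀.primeCompl g
  have ht := IsLocalization.map_units R t
  have h1 : mult R (algebraMap R₀ R t) = 0 := mult_eq_zero_iff.mpr ht
  have h2 : E.val hE (g * algebraMap R₀ R t) = E.val hE g + E.val hE (algebraMap R₀ R t) :=
    E.val_mul hE _ _
  rw [h, hvalR₀, hvalR₀, h1, add_zero, ← h, hmul, h1, add_zero] at h2
  exact h2.symm

end Izumi

theorem mainTheorem8 {X : Scheme.{0}} (s : X ⟶ Spec (.of ℂ)) (hX : Izumi.IsVariety s)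
    (x : X) (hx : IsClosed ({x} : Set X)) (hsm : Izumi.IsSmoothPoint s x) :
    -- the inequality
    (∀ (E : Izumi.DivisorOver s) (hE : x ∈ E.center), 2 ≤ Order.coheight E.centerPt →
      ∀ g : X.presheaf.stalk x,
        E.valMaximalIdeal hE * Izumi.mult (X.presheaf.stalk x) g ≤ E.val hE g ∧
        E.val hE g ≤ (E.discrepancy : ℕ∞) * Izumi.mult (X.presheaf.stalk x) g) ∧
    -- sharpness: if `X` is a surface, `mult_x` is such a valuation and gives equality
    (Order.coheight x = 2 →
      (∃ (E : Izumi.DivisorOver s) (hE : x ∈ E.center), 2 ≤ Order.coheight E.centerPt ∧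
        ∀ g : X.presheaf.stalk x, E.val hE g = Izumi.mult (X.presheaf.stalk x) g) ∧
      ∀ (E : Izumi.DivisorOver s) (hE : x ∈ E.center),
        (∀ g : X.presheaf.stalk x, E.val hE g = Izumi.mult (X.presheaf.stalk x) g) →
        ∀ g : X.presheaf.stalk x,
          E.val hE g = (E.discrepancy : ℕ∞) * Izumi.mult (X.presheaf.stalk x) g) := by
  have := hX.isIntegral
  have := hX.locallyOfFiniteType
  have : IsLocallyNoetherian X := LocallyOfFiniteType.isLocallyNoetherian s
  refine ⟨fun E hE hc g => ⟨E.valMaximalIdeal_mul_mult_le hE g,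
    (E.val_le_and_one_le_discrepancy hX hx hsm hE hc).2 g⟩, fun hdim => ⟨?_, fun E hE hv g => ?_⟩⟩
  · obtain ⟨E, hE, hc, hv⟩ := Izumi.exists_divisorOver_val_eq_mult hX hx hsm hdim
    exact ⟨E, hE, by rw [hc, hdim], hv⟩
  · have hc : 2 ≤ Order.coheight E.centerPt := by
      rw [E.centerPt_eq_of_val_eq_mult hE hv, hdim]
    have h1 : E.discrepancy = 1 := le_antisymm (E.discrepancy_le_one hX hx hsm hdim hE hv)
      (E.val_le_and_one_le_discrepancy hX hx hsm hE hc).1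
    rw [h1, hv, Nat.cast_one, one_mul]
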